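/- Let $\mathcal H,\mathcal J$ be separable complex Hilbert spaces and $\mathcal H\otimes\mathcal J$ their Hilbert space tensor product. Let $\mathcal T(\cdot)$ denote the trace class with the trace norm $\|A\|_1=\mathrm{tr}|A|$, and $\mathcal T(\cdot)_{\rm s}$ the real Banach space of self-adjoint trace class operators. Let $\mathcal T(\mathcal H)\hat\otimes_\pi\mathcal T(\mathcal J)$ (resp. $\mathcal T(\mathcal H)_{\rm s}\hat\otimes_\pi\mathcal T(\mathcal J)_{\rm s}$) be the complex (resp. real) projective tensor product, i.e. the completion of the algebraic tensor product in the norm $\inf\{\sum_k\|S_k\|_1\|T_k\|_1\}$ over finite decompositions $\sum_k S_k\otimes T_k$. Let $\iota:\mathcal T(\mathcal H)\hat\otimes_\pi\mathcal T(\mathcal J)\to\mathcal T(\mathcal H\otimes\mathcal J)$ and $\iota_{\rm s}:\mathcal T(\mathcal H)_{\rm s}\hat\otimes_\pi\mathcal T(\mathcal J)_{\rm s}\to\mathcal T(\mathcal H\otimes\mathcal J)_{\rm s}$ be the continuous linear maps extending $S\otimes T\mapsto S\otimes T$. Put $\mathcal C=\mathrm{ran}\,\iota$ (the cross trace class operators)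 and $\mathcal C_{\rm s}=\mathrm{ran}\,\iota_{\rm s}$ (the self-adjoint cross trace class operators). A standard decomposition of $C$ is a finite or countably infinite, trace-norm convergent expansion $C=\sum_k r_k\,(X_k\otimes Y_k)$ with $r_k\ge0$, $\sum_k r_k<\infty$, $X_k\in\mathcal T(\mathcal H)$, $Y_k\in\mathcal T(\mathcal J)$, $\|X_k\|_1\|Y_k\|_1=1$; it is Hermitian if all $X_k,Y_k$ are self-adjoint. Then: (1) $C\in\mathcal T(\mathcal H\otimes\mathcal J)$ lies in $\mathcal C$ if and only if it has a standard decomposition; moreover every $C\in\mathcal C$ has one in which all $X_k=|\eta_k\rangle\langle\phi_k|$, $Y_k=|\psi_k\rangle\langle\chi_k|$ are rank-one partial isometries ($\eta_k,\phi_k,\psi_k,\chi_k$ unit vectors). (2) Put $\|C\|_\pi=\inf\sum_k r_k$ over all standard decompositions of $C\in\mathcal C$. Then $(\mathcal C,\|\cdot\|_\pi)$ is a separable complex Banach space, and $\iota$ is an isometric isomorphism of $\mathcal T(\mathcal H)\hat\otimes_\pi\mathcal T(\mathcal J)$ onto it. The infimum is unchanged if only decompositions into rank-one partial isometries are allowed.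 Every standard decomposition of $C$ converges to $C$ absolutely with respect to both $\|\cdot\|_1$ and $\|\cdot\|_\pi$. (3) If $C=\sum_k r_k(X_k\otimes Y_k)$ is a standard decomposition, then $C^*=\sum_k r_k(X_k^*\otimes Y_k^*)$ is a standard decomposition of $C^*\in\mathcal C$; and $\|C^*\|_\pi=\|C\|_\pi$ for every $C\in\mathcal C$. (4) A self-adjoint trace class operator $C$ on $\mathcal H\otimes\mathcal J$ lies in $\mathcal C_{\rm s}$ if and only if it has a Hermitian standard decomposition. With the norm given by the infimum of $\sum_k r_k$ over all Hermitian standard decompositions, $\mathcal C_{\rm s}$ is a separable real Banach space, and $\iota_{\rm s}$ is an isometric isomorphism of $\mathcal T(\mathcal H)_{\rm s}\hat\otimes_\pi\mathcal T(\mathcal J)_{\rm s}$ onto it. Every Hermitian standard decomposition of $C$ converges to $C$ absolutely with respect to both $\|\cdot\|_1$ and this norm. (5) $\mathcal C_{\rm s}=\{C\in\mathcal C: C=C^*\}$. (6) $\mathcal C$ is closed under composition and adjoints, and $\|C_1C_2\|_\pi\le\|C_1\|_\pi\|C_2\|_\pi$; thus $(\mathcal C,\|\cdot\|_\pi)$,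 with composition and $C\mapsto C^*$, is a Banach $*$-algebra. -/

import Mathlib

open scoped InnerProductSpace TensorProduct ENNReal NNReal

noncomputable section

set_option linter.unusedSectionVars false

namespace CrossTrace

section TraceClass

variable {H : Type*} [NormedAddCommGroup H] [InnerProductSpace ℂ H] [CompleteSpace H]
variable {K : Type*} [NormedAddCommGroup K] [InnerProductSpace ℂ K] [CompleteSpace K]

/-- The trace of the absolute value `|A| = √(A⋆ A)`, as an extended nonnegative real, computed in
a Hilbert basis; `traceENorm_eq_tsum` shows that every Hilbert basis gives the same value. -/
def traceENorm (A : H →L[ℂ] H) : ℝ≥0∞ :=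
  ∑' i, ENNReal.ofReal (RCLike.re
    ⟪(exists_hilbertBasis ℂ H).choose_spec.choose i,
      CFC.abs A ((exists_hilbertBasis ℂ H).choose_spec.choose i)⟫_ℂ)

theorem parseval {ι : Type*} (b : HilbertBasis ι ℂ H) (x : H) :
    ∑' i, ‖⟪b i, x⟫_ℂ‖ₑ ^ 2 = ‖x‖ₑ ^ 2 := by
  have h := b.hasSum_inner_mul_inner x x
  have h2 : HasSum (fun i => ‖⟪b i, x⟫_ℂ‖ ^ 2) (‖x‖ ^ 2) := by
    have h3 := Complex.hasSum_re h
    convert h3 using 1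
    · ext i
      rw [← inner_conj_symm x (b i), ← Complex.normSq_eq_conj_mul_self, Complex.ofReal_re,
        Complex.normSq_eq_norm_sq]
    · have := inner_self_eq_norm_sq (𝕜 := ℂ) x
      simpa using this.symm
  have h4 := h2.tsum_eq
  have e1 : ∀ r : ℝ, 0 ≤ r → ENNReal.ofReal (r ^ 2) = ENNReal.ofReal r ^ 2 := fun r hr =>
    ENNReal.ofReal_pow hr 2
  rw [← ofReal_norm, ← e1 _ (norm_nonneg _), ← h4,
    ENNReal.ofReal_tsum_of_nonneg (fun i => by positivity) h2.summable]
  exact tsum_congr fun i => by rw [← ofReal_norm, e1 _ (norm_nonneg _)]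

theorem hs_adjoint {ι κ : Type*} (b : HilbertBasis ι ℂ H) (c : HilbertBasis κ ℂ K)
    (T : H →L[ℂ] K) :
    ∑' i, ‖T (b i)‖ₑ ^ 2 = ∑' j, ‖ContinuousLinearMap.adjoint T (c j)‖ₑ ^ 2 := by
  simp_rw [← parseval c (T _), ← parseval b (ContinuousLinearMap.adjoint T _)]
  rw [ENNReal.tsum_comm]
  refine tsum_congr fun j => tsum_congr fun i => ?_
  rw [ContinuousLinearMap.adjoint_inner_right, ← inner_conj_symm, ← ofReal_norm, ← ofReal_norm,
    RCLike.norm_conj]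

/-- Square root of the absolute value. -/
theorem abs_eq_sq (A : H →L[ℂ] H) : ∃ R : H →L[ℂ] H, IsSelfAdjoint R ∧ R * R = CFC.abs A :=
  ⟨CFC.sqrt (CFC.abs A), (CFC.sqrt_nonneg _).isSelfAdjoint,
    CFC.sqrt_mul_sqrt_self _ (CFC.abs_nonneg A)⟩

theorem inner_sq (R : H →L[ℂ] H) (hR : IsSelfAdjoint R) (x : H) :
    ENNReal.ofReal (RCLike.re ⟪x, (R * R) x⟫_ℂ) = ‖R x‖ₑ ^ 2 := by
  have : ⟪x, (R * R) x⟫_ℂ = ⟪R x, R x⟫_ℂ := by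
    rw [mul_apply_eq_comp, ← ContinuousLinearMap.adjoint_inner_left,
      ContinuousLinearMap.isSelfAdjoint_iff'.mp hR]
  rw [this, inner_self_eq_norm_sq, ENNReal.ofReal_pow (norm_nonneg _), ofReal_norm]

theorem traceENorm_eq_hs {ι : Type*} (b : HilbertBasis ι ℂ H) (A R : H →L[ℂ] H)
    (hR : IsSelfAdjoint R) (h : R * R = CFC.abs A) :
    traceENorm A = ∑' i, ‖R (b i)‖ₑ ^ 2 := by
  rw [traceENorm, ← h]
  simp_rw [inner_sq R hR]
  rw [hs_adjoint _ b, ContinuousLinearMap.isSelfAdjoint_iff'.mp hR]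

/-- Independence of the Hilbert basis. -/
theorem traceENorm_eq_tsum {ι : Type*} (b : HilbertBasis ι ℂ H) (A : H →L[ℂ] H) :
    traceENorm A = ∑' i, ENNReal.ofReal (RCLike.re ⟪b i, CFC.abs A (b i)⟫_ℂ) := by
  obtain ⟨R, hR, h⟩ := abs_eq_sq A
  rw [traceENorm_eq_hs b A R hR h, ← h]
  simp_rw [inner_sq R hR]

theorem traceENorm_smul (c : ℂ) (A : H →L[ℂ] H) :
    traceENorm (c • A) = ‖c‖ₑ * traceENorm A := by
  simp_rw [traceENorm, CFC.abs_smul, ← ENNReal.tsum_mul_left]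
  refine tsum_congr fun i => ?_
  rw [smul_apply, ← Complex.coe_smul, inner_smul_right]
  rw [← ofReal_norm c, ← ENNReal.ofReal_mul (norm_nonneg _)]
  simp

/-- Approximate polar decomposition. -/
theorem exists_polar (A : H →L[ℂ] H) {ε : ℝ} (hε : 0 < ε) :
    ∃ U : H →L[ℂ] H, ‖U‖ ≤ 1 ∧ ‖A - U * CFC.abs A‖ ≤ ε ∧ ‖CFC.abs A - star U * A‖ ≤ ε := by
  set P := CFC.abs A with hP
  have hP0 : 0 ≤ P := CFC.abs_nonneg A
  have hPsa : IsSelfAdjoint P := hP0.isSelfAdjoint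
  have hPP : P * P = star A * A := CFC.abs_mul_abs A
  have hsp : ∀ x ∈ spectrum ℝ P, 0 ≤ x := fun x hx => spectrum_nonneg_of_nonneg hP0 hx
  have hne : ∀ x ∈ spectrum ℝ P, x + ε ≠ 0 := fun x hx => by have := hsp x hx; positivity
  have hc1 : ContinuousOn (fun x : ℝ => (x + ε)⁻¹) (spectrum ℝ P) :=
    ContinuousOn.inv₀ (by fun_prop) hne
  have hcid : ContinuousOn (fun x : ℝ => x) (spectrum ℝ P) := continuousOn_id
  set Q := cfc (fun x : ℝ => (x + ε)⁻¹) P with hQ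
  have hQsa : IsSelfAdjoint Q := cfc_predicate _ P
  have hPid : P = cfc (fun x : ℝ => x) P := (cfc_id' ℝ P).symm
  have hQP : Q * P = cfc (fun x : ℝ => (x + ε)⁻¹ * x) P := by
    rw [cfc_mul _ _ P hc1 hcid, ← hPid]
  have hcomm : Q * P = P * Q := by
    have h := cfc_commute_cfc (fun x : ℝ => (x + ε)⁻¹) (fun x : ℝ => x) P
    rw [← hPid] at h
    exact h
  have hc2 : ContinuousOn (fun x : ℝ => (x + ε)⁻¹ * x) (spectrum ℝ P) := hc1.mul hcid
  have hQP1 : ‖Q * P‖ ≤ 1 := by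
    rw [hQP]
    refine norm_cfc_le zero_le_one fun x hx => ?_
    have h0 := hsp x hx
    rw [Real.norm_of_nonneg (by positivity), inv_mul_le_one₀ (by positivity)]
    linarith
  have hE : P - P * (Q * P) = cfc (fun x : ℝ => x - x * ((x + ε)⁻¹ * x)) P := by
    have hc3 : ContinuousOn (fun x : ℝ => x * ((x + ε)⁻¹ * x)) (spectrum ℝ P) := hcid.mul hc2
    rw [cfc_sub _ _ P hcid hc3, cfc_mul _ _ P hcid hc2, ← hPid, ← hQP]
  have hE1 : ‖P - P * (Q * P)‖ ≤ ε := by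
    rw [hE]
    refine norm_cfc_le hε.le fun x hx => ?_
    have h0 := hsp x hx
    have h1 := hne x hx
    have : x - x * ((x + ε)⁻¹ * x) = ε * ((x + ε)⁻¹ * x) := by field_simp; ring
    rw [this, Real.norm_of_nonneg (by positivity)]
    have : (x + ε)⁻¹ * x ≤ 1 := by
      rw [inv_mul_le_one₀ (by positivity)]
      linarith
    nlinarith
  have key : ∀ T : H →L[ℂ] H, ‖A * T‖ = ‖P * T‖ := by
    intro T
    have h1 : ‖A * T‖ * ‖A * T‖ = ‖P * T‖ * ‖P * T‖ := by
      rw [← CStarRing.norm_star_mul_self, ← CStarRing.norm_star_mul_self (x := P * T)]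
      simp only [star_mul, hPsa.star_eq]
      rw [mul_assoc, ← mul_assoc (star A), ← hPP]
      simp only [mul_assoc]
    nlinarith [norm_nonneg (A * T), norm_nonneg (P * T), mul_self_inj_of_nonneg
      (norm_nonneg (A * T)) (norm_nonneg (P * T)) |>.mp h1]
  refine ⟨A * Q, ?_, ?_, ?_⟩
  · rw [key, ← hcomm]; exact hQP1
  · have : A - A * Q * P = A * (1 - Q * P) := by rw [mul_sub, mul_one, mul_assoc]
    rw [this, key, mul_sub, mul_one]; exact hE1
  · have : star (A * Q) * A = P * (Q * P) := by
      rw [star_mul, hQsa.star_eq, mul_assoc, ← hPP, ← mul_assoc, ← mul_assoc, hcomm]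
    rw [this]; exact hE1

theorem hs_contraction_left {ι : Type*} (v : ι → H) (T L : H →L[ℂ] H) (hL : ‖L‖ ≤ 1) :
    ∑' i, ‖(L * T) (v i)‖ₑ ^ 2 ≤ ∑' i, ‖T (v i)‖ₑ ^ 2 := by
  refine ENNReal.tsum_le_tsum fun i => ?_
  gcongr
  rw [mul_apply_eq_comp, ← ofReal_norm, ← ofReal_norm]
  exact ENNReal.ofReal_le_ofReal ((L.le_opNorm _).trans (by nlinarith [norm_nonneg (T (v i))]))

theorem hs_contraction_right {ι : Type*} (b : HilbertBasis ι ℂ H) (T L : H →L[ℂ] H)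
    (hL : ‖L‖ ≤ 1) (hT : IsSelfAdjoint T) :
    ∑' i, ‖(T * L) (b i)‖ₑ ^ 2 ≤ ∑' i, ‖T (b i)‖ₑ ^ 2 := by
  rw [hs_adjoint b b]
  have : ContinuousLinearMap.adjoint (T * L) = star L * T := by
    rw [← ContinuousLinearMap.star_eq_adjoint, star_mul, hT.star_eq]
  rw [this]
  exact hs_contraction_left b T (star L) (by rwa [norm_star])

theorem sum_inner_le {ι : Type*} (b : HilbertBasis ι ℂ H) (A L M : H →L[ℂ] H)
    (hL : ‖L‖ ≤ 1) (hM : ‖M‖ ≤ 1) (F : Finset ι) :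
    ∑ i ∈ F, ‖⟪b i, (L * A * M) (b i)⟫_ℂ‖ₑ ≤ traceENorm A := by
  obtain ⟨R, hR, hRA⟩ := abs_eq_sq A
  have htr := traceENorm_eq_hs b A R hR hRA
  have step : ∀ ε : ℝ, 0 < ε → ∑ i ∈ F, ‖⟪b i, (L * A * M) (b i)⟫_ℂ‖ₑ ≤
      traceENorm A + F.card * ENNReal.ofReal ε := by
    intro ε hε
    obtain ⟨U, hU, h1, -⟩ := exists_polar A hε
    rw [← hRA] at h1
    have hLU : ‖star (L * U)‖ ≤ 1 := by
      rw [norm_star]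
      exact (norm_mul_le _ _).trans (by nlinarith [norm_nonneg L, norm_nonneg U])
    have hterm : ∀ i, ‖⟪b i, (L * A * M) (b i)⟫_ℂ‖ₑ ≤
        (‖(R * star (L * U)) (b i)‖ₑ ^ 2 + ‖(R * M) (b i)‖ₑ ^ 2) / 2 + ENNReal.ofReal ε := by
      intro i
      have hb : ‖b i‖ = 1 := b.orthonormal.1 i
      have e1 : ⟪b i, (L * A * M) (b i)⟫_ℂ =
          ⟪(R * star (L * U)) (b i), (R * M) (b i)⟫_ℂ +
            ⟪b i, (L * (A - U * (R * R)) * M) (b i)⟫_ℂ := by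
        have : (R * star (L * U)) = ContinuousLinearMap.adjoint (L * U * R) := by
          rw [← ContinuousLinearMap.star_eq_adjoint, star_mul (L * U), hR.star_eq]
        rw [this, ContinuousLinearMap.adjoint_inner_left, ← inner_add_right]
        congr 1
        rw [← mul_apply_eq_comp, ← add_apply]
        congr 1
        noncomm_ring
      have n1 : ‖⟪b i, (L * (A - U * (R * R)) * M) (b i)⟫_ℂ‖ ≤ ε := by
        refine (norm_inner_le_norm _ _).trans ?_
        rw [hb, one_mul]
        refine (ContinuousLinearMap.le_opNorm _ _).trans ?_
        rw [hb, mul_one]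
        calc _ ≤ ‖L‖ * ‖A - U * (R * R)‖ * ‖M‖ :=
              (norm_mul_le _ _).trans (by gcongr; exact norm_mul_le _ _)
          _ ≤ 1 * ε * 1 := by gcongr
          _ = ε := by ring
      have n2 : ‖⟪(R * star (L * U)) (b i), (R * M) (b i)⟫_ℂ‖ ≤
          (‖(R * star (L * U)) (b i)‖ ^ 2 + ‖(R * M) (b i)‖ ^ 2) / 2 := by
        refine (norm_inner_le_norm _ _).trans ?_
        nlinarith [sq_nonneg (‖(R * star (L * U)) (b i)‖ - ‖(R * M) (b i)‖)]
      have n3 := (norm_add_le _ _).trans (add_le_add n2 n1)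
      rw [← e1] at n3
      rw [← ofReal_norm]
      refine (ENNReal.ofReal_le_ofReal n3).trans ?_
      rw [ENNReal.ofReal_add (by positivity) hε.le, ENNReal.ofReal_div_of_pos two_pos,
        ENNReal.ofReal_add (by positivity) (by positivity), ENNReal.ofReal_pow (norm_nonneg _),
        ENNReal.ofReal_pow (norm_nonneg _), ofReal_norm, ofReal_norm, ENNReal.ofReal_ofNat]
    refine (Finset.sum_le_sum fun i _ => hterm i).trans ?_
    rw [Finset.sum_add_distrib, Finset.sum_const, nsmul_eq_mul]
    gcongr
    simp_rw [div_eq_mul_inv]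
    rw [← Finset.sum_mul, Finset.sum_add_distrib, ← div_eq_mul_inv]
    refine ENNReal.div_le_of_le_mul ?_
    rw [mul_two]
    refine add_le_add ?_ ?_
    · exact (ENNReal.sum_le_tsum F).trans ((hs_contraction_right b R _ hLU hR).trans htr.ge)
    · exact (ENNReal.sum_le_tsum F).trans ((hs_contraction_right b R _ hM hR).trans htr.ge)
  refine le_of_tendsto_of_tendsto' (b := nhdsWithin (0 : ℝ) (Set.Ioi 0))
    (f := fun _ => ∑ i ∈ F, ‖⟪b i, (L * A * M) (b i)⟫_ℂ‖ₑ)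
    (g := fun ε => if 0 < ε then traceENorm A + F.card * ENNReal.ofReal ε else ⊤)
    tendsto_const_nhds ?_ ?_
  · have : Filter.Tendsto (fun ε : ℝ => traceENorm A + F.card * ENNReal.ofReal ε)
        (nhdsWithin 0 (Set.Ioi 0)) (nhds (traceENorm A + F.card * ENNReal.ofReal 0)) := by
      refine Filter.Tendsto.mono_left ?_ nhdsWithin_le_nhds
      refine tendsto_const_nhds.add (ENNReal.Tendsto.const_mul ?_ (Or.inr (by simp)))
      exact (ENNReal.continuous_ofReal.tendsto 0)
    simp only [ENNReal.ofReal_zero, mul_zero, add_zero] at this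
    refine this.congr' ?_
    filter_upwards [self_mem_nhdsWithin] with ε hε
    rw [if_pos (Set.mem_Ioi.mp hε)]
  · intro ε
    by_cases h : 0 < ε
    · simp only [h, if_true]; exact step ε h
    · simp [h]

theorem traceENorm_le {ι : Type*} (b : HilbertBasis ι ℂ H) (A : H →L[ℂ] H) (m : ℝ≥0∞)
    (h : ∀ L : H →L[ℂ] H, ‖L‖ ≤ 1 → ∀ F : Finset ι,
      ∑ i ∈ F, ‖⟪b i, (L * A) (b i)⟫_ℂ‖ₑ ≤ m) : traceENorm A ≤ m := by
  rw [traceENorm_eq_tsum b, ENNReal.tsum_eq_iSup_sum]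
  refine iSup_le fun F => ?_
  refine ENNReal.le_of_forall_pos_le_add fun δ hδ _ => ?_
  obtain ⟨ε, hε, hεδ⟩ : ∃ ε : ℝ, 0 < ε ∧ F.card * ENNReal.ofReal ε ≤ δ := by
    refine ⟨δ / (F.card + 1), by positivity, ?_⟩
    rw [← ENNReal.ofReal_natCast, ← ENNReal.ofReal_mul (by positivity), ← ENNReal.ofReal_coe_nnreal]
    refine ENNReal.ofReal_le_ofReal ?_
    rw [mul_div_assoc', div_le_iff₀ (by positivity)]
    nlinarith [NNReal.coe_nonneg δ]
  obtain ⟨U, hU, -, h2⟩ := exists_polar A hε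
  have hterm : ∀ i, ENNReal.ofReal (RCLike.re ⟪b i, CFC.abs A (b i)⟫_ℂ) ≤
      ‖⟪b i, (star U * A) (b i)⟫_ℂ‖ₑ + ENNReal.ofReal ε := by
    intro i
    have hb : ‖b i‖ = 1 := b.orthonormal.1 i
    have e1 : ⟪b i, CFC.abs A (b i)⟫_ℂ =
        ⟪b i, (star U * A) (b i)⟫_ℂ + ⟪b i, (CFC.abs A - star U * A) (b i)⟫_ℂ := by
      rw [← inner_add_right, ← add_apply]
      congr 2
      abel
    have n1 : ‖⟪b i, (CFC.abs A - star U * A) (b i)⟫_ℂ‖ ≤ ε := by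
      refine (norm_inner_le_norm _ _).trans ?_
      rw [hb, one_mul]
      refine (ContinuousLinearMap.le_opNorm _ _).trans ?_
      rw [hb, mul_one]
      exact h2
    rw [← ofReal_norm, ← ENNReal.ofReal_add (norm_nonneg _) hε.le]
    refine ENNReal.ofReal_le_ofReal ((RCLike.re_le_norm _).trans ?_)
    rw [e1]
    exact (norm_add_le _ _).trans (by gcongr)
  calc _ ≤ ∑ i ∈ F, (‖⟪b i, (star U * A) (b i)⟫_ℂ‖ₑ + ENNReal.ofReal ε) :=
        Finset.sum_le_sum fun i _ => hterm i
    _ ≤ m + δ := by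
        rw [Finset.sum_add_distrib, Finset.sum_const, nsmul_eq_mul]
        exact add_le_add (h _ (by rwa [norm_star]) F) hεδ

theorem traceENorm_add_le (A B : H →L[ℂ] H) :
    traceENorm (A + B) ≤ traceENorm A + traceENorm B := by
  obtain ⟨w, b, -⟩ := exists_hilbertBasis ℂ H
  refine traceENorm_le b _ _ fun L hL F => ?_
  refine le_trans ?_ (add_le_add (sum_inner_le b A L 1 hL ContinuousLinearMap.norm_id_le F)
    (sum_inner_le b B L 1 hL ContinuousLinearMap.norm_id_le F))
  rw [← Finset.sum_add_distrib]
  refine Finset.sum_le_sum fun i _ => ?_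
  rw [mul_add, add_apply, inner_add_right, mul_one, mul_one]
  exact enorm_add_le _ _

theorem traceENorm_star_le (A : H →L[ℂ] H) : traceENorm (star A) ≤ traceENorm A := by
  obtain ⟨w, b, -⟩ := exists_hilbertBasis ℂ H
  refine traceENorm_le b _ _ fun L hL F => ?_
  refine le_trans (le_of_eq ?_) (sum_inner_le b A 1 (star L) ContinuousLinearMap.norm_id_le
    (by rwa [norm_star]) F)
  refine Finset.sum_congr rfl fun i _ => ?_
  have : L * star A = ContinuousLinearMap.adjoint (1 * A * star L) := by
    rw [← ContinuousLinearMap.star_eq_adjoint, one_mul, star_mul, star_star]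
  rw [this, ContinuousLinearMap.adjoint_inner_right, ← inner_conj_symm, ← ofReal_norm,
    ← ofReal_norm, RCLike.norm_conj]

theorem traceENorm_star (A : H →L[ℂ] H) : traceENorm (star A) = traceENorm A :=
  le_antisymm (traceENorm_star_le A) (by simpa using traceENorm_star_le (star A))

theorem traceENorm_mul_le (B A : H →L[ℂ] H) :
    traceENorm (B * A) ≤ ‖B‖ₑ * traceENorm A := by
  have h1 : ∀ L : H →L[ℂ] H, ‖L‖ ≤ 1 → traceENorm (L * A) ≤ traceENorm A := by
    intro L hL
    obtain ⟨w, b, -⟩ := exists_hilbertBasis ℂ H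
    refine traceENorm_le b _ _ fun M hM F => ?_
    refine le_trans (le_of_eq ?_) (sum_inner_le b A (M * L) 1
      ((norm_mul_le _ _).trans (by nlinarith [norm_nonneg L, norm_nonneg M]))
      ContinuousLinearMap.norm_id_le F)
    rw [mul_one, mul_assoc]
  by_cases hB : B = 0
  · have := traceENorm_smul (0 : ℂ) A
    simp only [zero_smul, enorm_zero, zero_mul] at this
    simp [hB, this]
  · have hB' : (‖B‖ : ℂ) ≠ 0 := by simpa using hB
    have : B * A = (‖B‖ : ℂ) • (((‖B‖ : ℂ)⁻¹ • B) * A) := by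
      rw [smul_mul_assoc, smul_smul, mul_inv_cancel₀ hB', one_smul]
    rw [this, traceENorm_smul]
    have e : ‖(‖B‖ : ℂ)‖ₑ = ‖B‖ₑ := by rw [← ofReal_norm, ← ofReal_norm]; simp
    rw [e]
    gcongr
    refine h1 _ ?_
    rw [norm_smul, norm_inv]
    simp [hB]

theorem enorm_le_traceENorm (A : H →L[ℂ] H) : ‖A‖ₑ ≤ traceENorm A := by
  obtain ⟨w, b, -⟩ := exists_hilbertBasis ℂ H
  obtain ⟨R, hR, hRA⟩ := abs_eq_sq A
  have htr := traceENorm_eq_hs b A R hR hRA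
  have h1 : ∀ x, ‖R x‖ₑ ^ 2 ≤ traceENorm A * ‖x‖ₑ ^ 2 := by
    intro x
    rw [← parseval b (R x), htr, ← ENNReal.tsum_mul_right]
    refine ENNReal.tsum_le_tsum fun i => ?_
    rw [← mul_pow]
    gcongr
    have : ⟪b i, R x⟫_ℂ = ⟪R (b i), x⟫_ℂ := by
      rw [← ContinuousLinearMap.adjoint_inner_left, ContinuousLinearMap.isSelfAdjoint_iff'.mp hR]
    rw [this, ← ofReal_norm, ← ofReal_norm, ← ofReal_norm, ← ENNReal.ofReal_mul (norm_nonneg _)]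
    exact ENNReal.ofReal_le_ofReal (norm_inner_le_norm _ _)
  by_cases ht : traceENorm A = ⊤
  · simp [ht]
  · set t := (traceENorm A).toReal with htt
    have ht' : traceENorm A = ENNReal.ofReal t := (ENNReal.ofReal_toReal ht).symm
    have h2 : ‖R‖ ≤ Real.sqrt t := by
      refine ContinuousLinearMap.opNorm_le_bound _ (Real.sqrt_nonneg _) fun x => ?_
      have := h1 x
      rw [ht', ← ofReal_norm, ← ofReal_norm, ← ENNReal.ofReal_pow (norm_nonneg _),
        ← ENNReal.ofReal_pow (norm_nonneg _), ← ENNReal.ofReal_mul ENNReal.toReal_nonneg,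
        ENNReal.ofReal_le_ofReal_iff (by positivity)] at this
      refine le_of_sq_le_sq ?_ (by positivity)
      rwa [mul_pow, Real.sq_sqrt ENNReal.toReal_nonneg]
    rw [ht', ← ofReal_norm, ← CFC.norm_abs (a := A), ← hRA]
    refine ENNReal.ofReal_le_ofReal ((norm_mul_le _ _).trans ?_)
    calc ‖R‖ * ‖R‖ ≤ Real.sqrt t * Real.sqrt t := by gcongr
      _ = t := Real.mul_self_sqrt ENNReal.toReal_nonneg

end TraceClass

section TraceClassSpace

variable (H : Type*) [NormedAddCommGroup H] [InnerProductSpace ℂ H] [CompleteSpace H]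

/-- The trace class operators on `H`: the bounded operators with `tr |A| < ∞`, as a `⋆`-subalgebra
of the bounded operators. -/
def traceClass : NonUnitalStarSubalgebra ℂ (H →L[ℂ] H) where
  carrier := {A | traceENorm A < ⊤}
  add_mem' ha hb := (traceENorm_add_le _ _).trans_lt (ENNReal.add_lt_top.mpr ⟨ha, hb⟩)
  zero_mem' := by
    have := traceENorm_smul (0 : ℂ) (0 : H →L[ℂ] H)
    rw [smul_zero, enorm_zero, zero_mul] at this
    simp [this]
  mul_mem' _ hb := (traceENorm_mul_le _ _).trans_lt (ENNReal.mul_lt_top enorm_lt_top hb)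
  smul_mem' c A ha := by
    simp only [Set.mem_ofPred_eq, traceENorm_smul]
    exact ENNReal.mul_lt_top enorm_lt_top ha
  star_mem' ha := by simpa only [Set.mem_ofPred_eq, traceENorm_star] using ha

/-- The Banach space of trace class operators on `H`. It is a type of its own, so that its norm is
the trace norm and not the operator norm. -/
def TraceClass : Type _ := traceClass H

variable {H}

namespace TraceClass

instance : NonUnitalRing (TraceClass H) := inferInstanceAs (NonUnitalRing (traceClass H))
instance : StarRing (TraceClass H) := inferInstanceAs (StarRing (traceClass H))
instance : Module ℂ (TraceClass H) := inferInstanceAs (Module ℂ (traceClass H))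
instance : StarModule ℂ (TraceClass H) := inferInstanceAs (StarModule ℂ (traceClass H))

/-- The bounded operator underlying a trace class operator. -/
def toCLM (A : TraceClass H) : H →L[ℂ] H := A.1

/-- A bounded operator with finite trace norm, as a trace class operator. -/
def mk (A : H →L[ℂ] H) (hA : traceENorm A < ⊤) : TraceClass H := ⟨A, hA⟩

@[simp] theorem toCLM_mk (A : H →L[ℂ] H) (hA : traceENorm A < ⊤) : (mk A hA).toCLM = A := rfl
@[ext] theorem ext {A B : TraceClass H} (h : A.toCLM = B.toCLM) : A = B := Subtype.ext h
@[simp] theorem toCLM_zero : (0 : TraceClass H).toCLM = 0 := rfl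
@[simp] theorem toCLM_add (A B : TraceClass H) : (A + B).toCLM = A.toCLM + B.toCLM := rfl
@[simp] theorem toCLM_sub (A B : TraceClass H) : (A - B).toCLM = A.toCLM - B.toCLM := rfl
@[simp] theorem toCLM_neg (A : TraceClass H) : (-A).toCLM = -A.toCLM := rfl
@[simp] theorem toCLM_smul (c : ℂ) (A : TraceClass H) : (c • A).toCLM = c • A.toCLM := rfl
@[simp] theorem toCLM_mul (A B : TraceClass H) : (A * B).toCLM = A.toCLM * B.toCLM := rfl
@[simp] theorem toCLM_star (A : TraceClass H) : (star A).toCLM = star A.toCLM := rfl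

theorem traceENorm_lt_top (A : TraceClass H) : traceENorm A.toCLM < ⊤ := A.2

/-- The trace norm `‖A‖₁ = tr |A|`. -/
instance : Norm (TraceClass H) := ⟨fun A => (traceENorm A.toCLM).toReal⟩

theorem norm_def (A : TraceClass H) : ‖A‖ = (traceENorm A.toCLM).toReal := rfl

theorem ofReal_norm_eq (A : TraceClass H) : ENNReal.ofReal ‖A‖ = traceENorm A.toCLM :=
  ENNReal.ofReal_toReal A.traceENorm_lt_top.ne

theorem opNorm_le (A : TraceClass H) : ‖A.toCLM‖ ≤ ‖A‖ := by
  have h := enorm_le_traceENorm A.toCLM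
  rw [← ofReal_norm_eq, ← ofReal_norm] at h
  exact (ENNReal.ofReal_le_ofReal_iff ENNReal.toReal_nonneg).mp h

theorem core : NormedSpace.Core ℂ (TraceClass H) where
  norm_nonneg _ := ENNReal.toReal_nonneg
  norm_smul c A := by
    rw [norm_def, toCLM_smul, traceENorm_smul, ENNReal.toReal_mul, toReal_enorm, norm_def]
  norm_triangle A B := by
    rw [norm_def, norm_def, norm_def,
      ← ENNReal.toReal_add A.traceENorm_lt_top.ne B.traceENorm_lt_top.ne]
    exact ENNReal.toReal_mono (ENNReal.add_lt_top.mpr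
      ⟨A.traceENorm_lt_top, B.traceENorm_lt_top⟩).ne (traceENorm_add_le _ _)
  norm_eq_zero_iff A := by
    refine ⟨fun h => TraceClass.ext ?_, fun h => ?_⟩
    · have := opNorm_le A
      rw [h] at this
      simpa using this
    · have := traceENorm_smul (0 : ℂ) (0 : H →L[ℂ] H)
      rw [smul_zero, enorm_zero, zero_mul] at this
      rw [h, norm_def, toCLM_zero, this, ENNReal.toReal_zero]

instance : NormedAddCommGroup (TraceClass H) := NormedAddCommGroup.ofCore core
instance : NormedSpace ℂ (TraceClass H) := NormedSpace.ofCore core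

instance : NormedStarGroup (TraceClass H) where
  norm_star_le A := by rw [norm_def, toCLM_star, traceENorm_star, norm_def]

instance : CompleteSpace (TraceClass H) := by
  refine Metric.complete_of_cauchySeq_tendsto fun u hu => ?_
  have hu' : CauchySeq fun n => (u n).toCLM := by
    rw [Metric.cauchySeq_iff] at hu ⊢
    intro ε hε
    obtain ⟨N, hN⟩ := hu ε hε
    refine ⟨N, fun m hm n hn => ?_⟩
    have h1 := hN m hm n hn
    rw [dist_eq_norm] at h1 ⊢
    exact (opNorm_le (u m - u n)).trans_lt h1
  obtain ⟨A, hA⟩ := cauchySeq_tendsto_of_complete hu'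
  obtain ⟨w, b, -⟩ := exists_hilbertBasis ℂ H
  have key : ∀ ε : ℝ, 0 < ε → ∃ N, ∀ n ≥ N, traceENorm ((u n).toCLM - A) ≤ ENNReal.ofReal ε := by
    intro ε hε
    obtain ⟨N, hN⟩ := Metric.cauchySeq_iff.mp hu ε hε
    refine ⟨N, fun n hn => traceENorm_le b _ _ fun L hL F => ?_⟩
    have ht : Filter.Tendsto
        (fun m => ∑ i ∈ F, ‖⟪b i, (L * ((u n).toCLM - (u m).toCLM)) (b i)⟫_ℂ‖ₑ) Filter.atTop
        (nhds (∑ i ∈ F, ‖⟪b i, (L * ((u n).toCLM - A)) (b i)⟫_ℂ‖ₑ)) := by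
      refine tendsto_finsetSum _ fun i _ => ?_
      have hc : Continuous fun B : H →L[ℂ] H =>
          ‖⟪b i, (L * ((u n).toCLM - B)) (b i)⟫_ℂ‖ₑ := by fun_prop
      exact (hc.tendsto A).comp hA
    refine le_of_tendsto ht ?_
    filter_upwards [Filter.eventually_ge_atTop N] with m hm
    have h1 := sum_inner_le b ((u n).toCLM - (u m).toCLM) L 1 hL
      ContinuousLinearMap.norm_id_le F
    rw [mul_one] at h1
    refine h1.trans ?_
    have h2 := hN n hn m hm
    rw [dist_eq_norm] at h2
    rw [← toCLM_sub, ← ofReal_norm_eq]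
    exact ENNReal.ofReal_le_ofReal h2.le
  obtain ⟨N, hN⟩ := key 1 one_pos
  have hAtop : traceENorm A < ⊤ := by
    have h1 : traceENorm ((u N).toCLM - A) < ⊤ := (hN N le_rfl).trans_lt ENNReal.ofReal_lt_top
    have h2 := (traceClass H).sub_mem (u N).2 h1
    have h3 : (u N).toCLM - ((u N).toCLM - A) = A := by abel
    exact h3 ▸ h2
  refine ⟨mk A hAtop, Metric.tendsto_atTop.mpr fun ε hε => ?_⟩
  obtain ⟨N, hN⟩ := key (ε / 2) (half_pos hε)
  refine ⟨N, fun n hn => ?_⟩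
  rw [dist_eq_norm]
  have h1 := hN n hn
  have h2 : traceENorm (u n - mk A hAtop).toCLM ≤ ENNReal.ofReal (ε / 2) := h1
  rw [← ofReal_norm_eq, ENNReal.ofReal_le_ofReal_iff (half_pos hε).le] at h2
  linarith

end TraceClass

end TraceClassSpace

section HilbertTensor

variable {H : Type*} [NormedAddCommGroup H] [InnerProductSpace ℂ H] [CompleteSpace H]
variable {J : Type*} [NormedAddCommGroup J] [InnerProductSpace ℂ J] [CompleteSpace J]

/-- The tensor product Hilbert space: the completion of the algebraic tensor product with respect
to the inner product `⟪x ⊗ y, x' ⊗ y'⟫ = ⟪x, x'⟫ * ⟪y, y'⟫`. -/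
def HilbertTensor (H J : Type*) [NormedAddCommGroup H] [InnerProductSpace ℂ H]
    [NormedAddCommGroup J] [InnerProductSpace ℂ J] : Type _ :=
  UniformSpace.Completion (H ⊗[ℂ] J)

instance (H J : Type*) [NormedAddCommGroup H] [InnerProductSpace ℂ H]
    [NormedAddCommGroup J] [InnerProductSpace ℂ J] : NormedAddCommGroup (HilbertTensor H J) :=
  inferInstanceAs (NormedAddCommGroup (UniformSpace.Completion (H ⊗[ℂ] J)))

instance (H J : Type*) [NormedAddCommGroup H] [InnerProductSpace ℂ H]
    [NormedAddCommGroup J] [InnerProductSpace ℂ J] : InnerProductSpace ℂ (HilbertTensor H J) :=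
  inferInstanceAs (InnerProductSpace ℂ (UniformSpace.Completion (H ⊗[ℂ] J)))

instance (H J : Type*) [NormedAddCommGroup H] [InnerProductSpace ℂ H]
    [NormedAddCommGroup J] [InnerProductSpace ℂ J] : CompleteSpace (HilbertTensor H J) :=
  inferInstanceAs (CompleteSpace (UniformSpace.Completion (H ⊗[ℂ] J)))

/-- The inclusion of the algebraic tensor product in the tensor product Hilbert space. -/
def hilbertIncl (H J : Type*) [NormedAddCommGroup H] [InnerProductSpace ℂ H]
    [NormedAddCommGroup J] [InnerProductSpace ℂ J] : H ⊗[ℂ] J →ₗᵢ[ℂ] HilbertTensor H J :=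
  (UniformSpace.Completion.toComplₗᵢ : H ⊗[ℂ] J →ₗᵢ[ℂ] UniformSpace.Completion (H ⊗[ℂ] J))

theorem hilbertIncl_dense : DenseRange (hilbertIncl H J).toContinuousLinearMap :=
  UniformSpace.Completion.denseRange_coe (α := H ⊗[ℂ] J)

/-- The simple tensor `x ⊗ y` in the tensor product Hilbert space. -/
def hilbertTmul (x : H) (y : J) : HilbertTensor H J := hilbertIncl H J (x ⊗ₜ[ℂ] y)

/-- The tensor product `A ⊗ B` of bounded operators: the continuous extension to the Hilbert space
tensor product of the algebraic tensor product of `A` and `B`. -/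
def opTensor (A : H →L[ℂ] H) (B : J →L[ℂ] J) : HilbertTensor H J →L[ℂ] HilbertTensor H J :=
  ((hilbertIncl H J).toContinuousLinearMap.comp (TensorProduct.mapL A B)).extend
    (hilbertIncl H J).toContinuousLinearMap

theorem opTensor_tmul (A : H →L[ℂ] H) (B : J →L[ℂ] J) (x : H) (y : J) :
    opTensor A B (hilbertTmul x y) = hilbertTmul (A x) (B y) :=
  ContinuousLinearMap.extend_eq _ hilbertIncl_dense
    (hilbertIncl H J).isometry.isUniformInducing (x ⊗ₜ[ℂ] y)

theorem hilbertTmul_add_left (x x' : H) (y : J) :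
    hilbertTmul (x + x') y = hilbertTmul x y + hilbertTmul x' y := by
  rw [hilbertTmul, TensorProduct.add_tmul, map_add]; rfl

theorem hilbertTmul_add_right (x : H) (y y' : J) :
    hilbertTmul x (y + y') = hilbertTmul x y + hilbertTmul x y' := by
  rw [hilbertTmul, TensorProduct.tmul_add, map_add]; rfl

theorem hilbertTmul_smul_left (c : ℂ) (x : H) (y : J) :
    hilbertTmul (c • x) y = c • hilbertTmul x y := by
  rw [hilbertTmul, ← TensorProduct.smul_tmul', map_smul]; rfl

theorem hilbertTmul_smul_right (c : ℂ) (x : H) (y : J) :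
    hilbertTmul x (c • y) = c • hilbertTmul x y := by
  rw [hilbertTmul, TensorProduct.tmul_smul, map_smul]; rfl

theorem inner_hilbertTmul (x x' : H) (y y' : J) :
    ⟪hilbertTmul x y, hilbertTmul x' y'⟫_ℂ = ⟪x, x'⟫_ℂ * ⟪y, y'⟫_ℂ := by
  rw [hilbertTmul, hilbertTmul, LinearIsometry.inner_map_map, TensorProduct.inner_tmul]

theorem op_ext {E : Type*} [NormedAddCommGroup E] [NormedSpace ℂ E]
    {S T : HilbertTensor H J →L[ℂ] E}
    (h : ∀ x y, S (hilbertTmul x y) = T (hilbertTmul x y)) : S = T := by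
  have h1 : S.comp (hilbertIncl H J).toContinuousLinearMap =
      T.comp (hilbertIncl H J).toContinuousLinearMap :=
    ContinuousLinearMap.coe_inj.mp (TensorProduct.ext' h)
  have h2 := hilbertIncl_dense.equalizer S.continuous T.continuous
    (funext fun t => congrArg (fun f => f t) h1)
  exact ContinuousLinearMap.coeFn_injective h2

theorem opTensor_mul (A A' : H →L[ℂ] H) (B B' : J →L[ℂ] J) :
    opTensor (A * A') (B * B') = opTensor A B * opTensor A' B' :=
  op_ext fun x y => by simp only [mul_apply_eq_comp, opTensor_tmul]

theorem opTensor_add_left (A A' : H →L[ℂ] H) (B : J →L[ℂ] J) :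
    opTensor (A + A') B = opTensor A B + opTensor A' B :=
  op_ext fun x y => by simp only [add_apply, opTensor_tmul, hilbertTmul_add_left]

theorem opTensor_add_right (A : H →L[ℂ] H) (B B' : J →L[ℂ] J) :
    opTensor A (B + B') = opTensor A B + opTensor A B' :=
  op_ext fun x y => by simp only [add_apply, opTensor_tmul, hilbertTmul_add_right]

theorem opTensor_smul_left (c : ℂ) (A : H →L[ℂ] H) (B : J →L[ℂ] J) :
    opTensor (c • A) B = c • opTensor A B :=
  op_ext fun x y => by simp only [smul_apply, opTensor_tmul, hilbertTmul_smul_left]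

theorem opTensor_smul_right (c : ℂ) (A : H →L[ℂ] H) (B : J →L[ℂ] J) :
    opTensor A (c • B) = c • opTensor A B :=
  op_ext fun x y => by simp only [smul_apply, opTensor_tmul, hilbertTmul_smul_right]

theorem opTensor_star (A : H →L[ℂ] H) (B : J →L[ℂ] J) :
    opTensor (star A) (star B) = star (opTensor A B) := by
  refine op_ext fun x y => ?_
  have h : innerSL ℂ (opTensor (star A) (star B) (hilbertTmul x y)) =
      innerSL ℂ (star (opTensor A B) (hilbertTmul x y)) := by
    refine op_ext fun x' y' => ?_
    rw [innerSL_apply_apply, innerSL_apply_apply, ContinuousLinearMap.star_eq_adjoint (opTensor A B),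
      ContinuousLinearMap.adjoint_inner_left, opTensor_tmul, opTensor_tmul, inner_hilbertTmul,
      inner_hilbertTmul, ContinuousLinearMap.star_eq_adjoint, ContinuousLinearMap.star_eq_adjoint,
      ContinuousLinearMap.adjoint_inner_left, ContinuousLinearMap.adjoint_inner_left]
  exact innerSL_inj.mp h

theorem opTensor_abs (A : H →L[ℂ] H) (B : J →L[ℂ] J) :
    CFC.abs (opTensor A B) = opTensor (CFC.abs A) (CFC.abs B) := by
  refine CFC.sqrt_unique ?_ ?_
  · rw [← opTensor_mul, CFC.abs_mul_abs, CFC.abs_mul_abs, opTensor_mul, opTensor_star]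
  · obtain ⟨R, hR, hRA⟩ := abs_eq_sq A
    obtain ⟨S, hS, hSB⟩ := abs_eq_sq B
    have h : opTensor (CFC.abs A) (CFC.abs B) = star (opTensor R S) * opTensor R S := by
      rw [← opTensor_star, hR.star_eq, hS.star_eq, ← opTensor_mul, hRA, hSB]
    rw [h]
    exact star_mul_self_nonneg _

/-- The product of two Hilbert bases is a Hilbert basis of the tensor product. -/
theorem exists_tensorBasis {ι κ : Type*} (b : HilbertBasis ι ℂ H) (c : HilbertBasis κ ℂ J) :
    ∃ d : HilbertBasis (ι × κ) ℂ (HilbertTensor H J), ∀ i, d i = hilbertTmul (b i.1) (c i.2) := by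
  have ho : Orthonormal ℂ fun i : ι × κ => hilbertTmul (b i.1) (c i.2) := by
    have := (b.orthonormal.tmul c.orthonormal).comp_linearIsometry
      (hilbertIncl H J)
    exact this
  have hbot : (Submodule.span ℂ (Set.range fun i : ι × κ => hilbertTmul (b i.1) (c i.2)))ᗮ = ⊥ := by
    rw [Submodule.eq_bot_iff]
    intro v hv
    have h0 : ∀ i j, ⟪v, hilbertTmul (b i) (c j)⟫_ℂ = 0 := fun i j =>
      Submodule.inner_left_of_mem_orthogonal (Submodule.subset_span (Set.mem_range_self (i, j))) hv
    have hcR : ∀ x : H, Continuous fun y : J => ⟪v, hilbertTmul x y⟫_ℂ := fun x => by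
      have h1 : Continuous fun y : J => x ⊗ₜ[ℂ] y := (TensorProduct.mkL ℂ H J x).continuous
      have h2 := (hilbertIncl H J).continuous.comp h1
      exact (innerSL ℂ v).continuous.comp h2
    have hcL : ∀ y : J, Continuous fun x : H => ⟪v, hilbertTmul x y⟫_ℂ := fun y => by
      have h1 : Continuous fun x : H => x ⊗ₜ[ℂ] y :=
        ((TensorProduct.mkL ℂ H J).flip y).continuous
      have h2 := (hilbertIncl H J).continuous.comp h1
      exact (innerSL ℂ v).continuous.comp h2
    have h1 : ∀ i y, ⟪v, hilbertTmul (b i) y⟫_ℂ = 0 := by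
      intro i y
      have hd : y ∈ closure (Submodule.span ℂ (Set.range c) : Set J) := by
        rw [← Submodule.topologicalClosure_coe, c.dense_span]; trivial
      refine closure_minimal (t := {y | ⟪v, hilbertTmul (b i) y⟫_ℂ = 0}) ?_
        (isClosed_eq (hcR _) continuous_const) hd
      intro z hz
      refine Submodule.span_induction (p := fun z _ => ⟪v, hilbertTmul (b i) z⟫_ℂ = 0)
        ?_ (by simp [hilbertTmul]) ?_ ?_ hz
      · rintro _ ⟨j, rfl⟩; exact h0 i j
      · intro z z' _ _ e e'
        rw [hilbertTmul_add_right, inner_add_right, e, e', add_zero]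
      · intro a z _ e
        rw [hilbertTmul_smul_right, inner_smul_right, e, mul_zero]
    have h2 : ∀ x y, ⟪v, hilbertTmul x y⟫_ℂ = 0 := by
      intro x y
      have hd : x ∈ closure (Submodule.span ℂ (Set.range b) : Set H) := by
        rw [← Submodule.topologicalClosure_coe, b.dense_span]; trivial
      refine closure_minimal (t := {x | ⟪v, hilbertTmul x y⟫_ℂ = 0}) ?_
        (isClosed_eq (hcL _) continuous_const) hd
      intro z hz
      refine Submodule.span_induction (p := fun z _ => ⟪v, hilbertTmul z y⟫_ℂ = 0)
        ?_ (by simp [hilbertTmul]) ?_ ?_ hz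
      · rintro _ ⟨j, rfl⟩; exact h1 j y
      · intro z z' _ _ e e'
        rw [hilbertTmul_add_left, inner_add_right, e, e', add_zero]
      · intro a z _ e
        rw [hilbertTmul_smul_left, inner_smul_right, e, mul_zero]
    have h3 : innerSL ℂ v = 0 := op_ext fun x y => by simpa using h2 x y
    have h4 := congrArg (fun f => f v) h3
    simpa using h4
  exact ⟨HilbertBasis.mkOfOrthogonalEqBot ho hbot, fun i => by
    rw [HilbertBasis.coe_mkOfOrthogonalEqBot]⟩

theorem traceENorm_opTensor (A : H →L[ℂ] H) (B : J →L[ℂ] J) :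
    traceENorm (opTensor A B) = traceENorm A * traceENorm B := by
  obtain ⟨w, b, -⟩ := exists_hilbertBasis ℂ H
  obtain ⟨w', c, -⟩ := exists_hilbertBasis ℂ J
  obtain ⟨d, hd⟩ := exists_tensorBasis b c
  obtain ⟨R, hR, hRA⟩ := abs_eq_sq A
  obtain ⟨S, hS, hSB⟩ := abs_eq_sq B
  rw [traceENorm_eq_hs b A R hR hRA, traceENorm_eq_hs c B S hS hSB,
    traceENorm_eq_hs d (opTensor A B) (opTensor R S)
      (by rw [IsSelfAdjoint, ← opTensor_star, hR.star_eq, hS.star_eq])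
      (by rw [opTensor_abs, ← opTensor_mul, hRA, hSB]), ENNReal.tsum_prod', ← ENNReal.tsum_mul_right]
  refine tsum_congr fun i => ?_
  rw [← ENNReal.tsum_mul_left]
  refine tsum_congr fun j => ?_
  rw [hd, opTensor_tmul, hilbertTmul, ← mul_pow, ← ofReal_norm, LinearIsometry.norm_map,
    TensorProduct.norm_tmul, ENNReal.ofReal_mul (norm_nonneg _), ofReal_norm, ofReal_norm]

namespace TraceClass

/-- The tensor product `S ⊗ T` of trace class operators, a trace class operator on the tensor
product Hilbert space. -/
def tensor (S : TraceClass H) (T : TraceClass J) : TraceClass (HilbertTensor H J) :=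
  mk (opTensor S.toCLM T.toCLM) (by
    rw [traceENorm_opTensor]
    exact ENNReal.mul_lt_top S.traceENorm_lt_top T.traceENorm_lt_top)

theorem norm_tensor (S : TraceClass H) (T : TraceClass J) : ‖tensor S T‖ = ‖S‖ * ‖T‖ := by
  rw [norm_def, tensor, toCLM_mk, traceENorm_opTensor, ENNReal.toReal_mul, norm_def, norm_def]

theorem star_tensor (S : TraceClass H) (T : TraceClass J) :
    star (tensor S T) = tensor (star S) (star T) :=
  TraceClass.ext (opTensor_star S.toCLM T.toCLM).symm

/-- The natural bilinear map `(S, T) ↦ S ⊗ T`. -/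
def tensorBilin : TraceClass H →L[ℂ] TraceClass J →L[ℂ] TraceClass (HilbertTensor H J) :=
  LinearMap.mkContinuous₂
    (LinearMap.mk₂ ℂ tensor
      (fun _ _ _ => TraceClass.ext (opTensor_add_left _ _ _))
      (fun _ _ _ => TraceClass.ext (opTensor_smul_left _ _ _))
      (fun _ _ _ => TraceClass.ext (opTensor_add_right _ _ _))
      (fun _ _ _ => TraceClass.ext (opTensor_smul_right _ _ _)))
    1 fun S T => by rw [one_mul]; exact (norm_tensor S T).le

@[simp] theorem tensorBilin_apply (S : TraceClass H) (T : TraceClass J) :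
    tensorBilin S T = tensor S T := rfl

end TraceClass

/-- The real Banach space of self-adjoint trace class operators, with the trace norm. -/
abbrev TraceClassSA (H : Type*) [NormedAddCommGroup H] [InnerProductSpace ℂ H] [CompleteSpace H] :
    Type _ :=
  selfAdjoint.submodule ℝ (TraceClass H)

namespace TraceClassSA

instance : CompleteSpace (TraceClassSA H) :=
  (isClosed_eq continuous_star continuous_id :
    IsClosed {A : TraceClass H | star A = A}).completeSpace_coe

/-- The tensor product of self-adjoint trace class operators. -/
def tensor (S : TraceClassSA H) (T : TraceClassSA J) : TraceClassSA (HilbertTensor H J) :=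
  ⟨TraceClass.tensor S.1 T.1, by
    have hS : star S.1 = S.1 := S.2
    have hT : star T.1 = T.1 := T.2
    change star (TraceClass.tensor S.1 T.1) = TraceClass.tensor S.1 T.1
    rw [TraceClass.star_tensor, hS, hT]⟩

/-- The natural real bilinear map `(S, T) ↦ S ⊗ T` on self-adjoint trace class operators. -/
def tensorBilin : TraceClassSA H →L[ℝ] TraceClassSA J →L[ℝ] TraceClassSA (HilbertTensor H J) :=
  LinearMap.mkContinuous₂
    (LinearMap.mk₂ ℝ tensor
      (fun _ _ _ => Subtype.ext (TraceClass.ext (opTensor_add_left _ _ _)))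
      (fun _ _ _ => Subtype.ext (TraceClass.ext (opTensor_smul_left _ _ _)))
      (fun _ _ _ => Subtype.ext (TraceClass.ext (opTensor_add_right _ _ _)))
      (fun _ _ _ => Subtype.ext (TraceClass.ext (opTensor_smul_right _ _ _))))
    1 fun S T => by rw [one_mul]; exact (TraceClass.norm_tensor S.1 T.1).le

end TraceClassSA

end HilbertTensor

section Projective

variable (𝕜 E F : Type*) [RCLike 𝕜] [SeminormedAddCommGroup E] [NormedSpace 𝕜 E]
  [SeminormedAddCommGroup F] [NormedSpace 𝕜 F]

/-- The algebraic tensor product `E ⊗ F`, to be normed by the projective norm. -/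
def ProjectiveAlg : Type _ := E ⊗[𝕜] F

instance : AddCommGroup (ProjectiveAlg 𝕜 E F) := inferInstanceAs (AddCommGroup (E ⊗[𝕜] F))
instance : Module 𝕜 (ProjectiveAlg 𝕜 E F) := inferInstanceAs (Module 𝕜 (E ⊗[𝕜] F))

variable {𝕜 E F}

/-- The sums `∑ ‖x_k‖ ‖y_k‖` over all finite decompositions `t = ∑ x_k ⊗ y_k`. -/
def projectiveSums (t : E ⊗[𝕜] F) : Set ℝ :=
  {s | ∃ (n : ℕ) (x : Fin n → E) (y : Fin n → F),
    t = ∑ k, x k ⊗ₜ[𝕜] y k ∧ s = ∑ k, ‖x k‖ * ‖y k‖}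

/-- The projective norm: the infimum of `∑ ‖x_k‖ ‖y_k‖` over all finite decompositions
`t = ∑ x_k ⊗ y_k`. -/
instance : Norm (ProjectiveAlg 𝕜 E F) := ⟨fun t => sInf (projectiveSums (𝕜 := 𝕜) t)⟩

theorem projectiveSums_nonneg (t : E ⊗[𝕜] F) : ∀ s ∈ projectiveSums t, 0 ≤ s := by
  rintro _ ⟨n, x, y, -, rfl⟩
  positivity

theorem projectiveSums_bddBelow (t : E ⊗[𝕜] F) : BddBelow (projectiveSums t) :=
  ⟨0, fun _ h => projectiveSums_nonneg t _ h⟩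

theorem projectiveSums_add {t u : E ⊗[𝕜] F} {a b : ℝ} (ha : a ∈ projectiveSums t)
    (hb : b ∈ projectiveSums u) : a + b ∈ projectiveSums (t + u) := by
  obtain ⟨n, x, y, rfl, rfl⟩ := ha
  obtain ⟨m, z, w, rfl, rfl⟩ := hb
  exact ⟨n + m, Fin.append x z, Fin.append y w, by simp [Fin.sum_univ_add],
    by simp [Fin.sum_univ_add]⟩

theorem projectiveSums_smul {t : E ⊗[𝕜] F} {a : ℝ} (c : 𝕜) (ha : a ∈ projectiveSums t) :
    ‖c‖ * a ∈ projectiveSums (c • t) := by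
  obtain ⟨n, x, y, rfl, rfl⟩ := ha
  exact ⟨n, fun k => c • x k, y, by simp [Finset.smul_sum, TensorProduct.smul_tmul'],
    by simp [Finset.mul_sum, norm_smul, mul_assoc]⟩

theorem projectiveSums_nonempty (t : E ⊗[𝕜] F) : (projectiveSums t).Nonempty := by
  induction t using TensorProduct.induction_on with
  | zero => exact ⟨0, 0, Fin.elim0, Fin.elim0, by simp, by simp⟩
  | tmul x y => exact ⟨‖x‖ * ‖y‖, 1, fun _ => x, fun _ => y, by simp, by simp⟩
  | add t u ht hu => exact ⟨_, projectiveSums_add ht.some_mem hu.some_mem⟩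

theorem projectiveAlg_core : SeminormedSpace.Core 𝕜 (ProjectiveAlg 𝕜 E F) where
  norm_nonneg t := Real.sInf_nonneg (projectiveSums_nonneg (𝕜 := 𝕜) t)
  norm_triangle t u := by
    have h : ∀ a ∈ projectiveSums (𝕜 := 𝕜) t, ∀ b ∈ projectiveSums (𝕜 := 𝕜) u,
        ‖t + u‖ ≤ a + b := fun a ha b hb =>
      csInf_le (projectiveSums_bddBelow _) (projectiveSums_add ha hb)
    have h1 : ∀ a ∈ projectiveSums (𝕜 := 𝕜) t, ‖t + u‖ - a ≤ ‖u‖ := fun a ha =>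
      le_csInf (projectiveSums_nonempty _) fun b hb => by linarith [h a ha b hb]
    have h2 : ‖t + u‖ - ‖u‖ ≤ ‖t‖ :=
      le_csInf (projectiveSums_nonempty _) fun a ha => by linarith [h1 a ha]
    linarith
  norm_smul c t := by
    have h : ∀ (c : 𝕜) (t : ProjectiveAlg 𝕜 E F), ‖c • t‖ ≤ ‖c‖ * ‖t‖ := by
      intro c t
      change sInf (projectiveSums (𝕜 := 𝕜) (c • t)) ≤ ‖c‖ * sInf (projectiveSums (𝕜 := 𝕜) t)
      rw [← smul_eq_mul, ← Real.sInf_smul_of_nonneg (norm_nonneg c)]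
      refine le_csInf ((projectiveSums_nonempty (𝕜 := 𝕜) t).image _) ?_
      rintro _ ⟨a, ha, rfl⟩
      exact csInf_le (projectiveSums_bddBelow _) (projectiveSums_smul c ha)
    refine le_antisymm (h c t) ?_
    by_cases hc : c = 0
    · rw [hc, norm_zero, zero_mul]
      exact Real.sInf_nonneg (projectiveSums_nonneg (𝕜 := 𝕜) _)
    · have h1 := h c⁻¹ (c • t)
      rw [smul_smul, inv_mul_cancel₀ hc, one_smul, norm_inv] at h1
      have hc' : 0 < ‖c‖ := norm_pos_iff.mpr hc
      calc ‖c‖ * ‖t‖ ≤ ‖c‖ * (‖c‖⁻¹ * ‖c • t‖) := by gcongr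
        _ = ‖c • t‖ := by field_simp

instance : SeminormedAddCommGroup (ProjectiveAlg 𝕜 E F) :=
  SeminormedAddCommGroup.ofCore projectiveAlg_core
instance : NormedSpace 𝕜 (ProjectiveAlg 𝕜 E F) where
  norm_smul_le c t := (projectiveAlg_core.norm_smul c t).le

variable (𝕜 E F) in
/-- The projective tensor product: the completion of `E ⊗ F` in the projective norm. -/
abbrev ProjectiveTensor : Type _ := UniformSpace.Completion (ProjectiveAlg 𝕜 E F)

variable (𝕜) in
/-- The simple tensor `x ⊗ y` in the projective tensor product. -/
def projTmul (x : E) (y : F) : ProjectiveTensor 𝕜 E F :=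
  UniformSpace.Completion.coe' (α := ProjectiveAlg 𝕜 E F) (x ⊗ₜ[𝕜] y : E ⊗[𝕜] F)

variable {G : Type*} [NormedAddCommGroup G] [NormedSpace 𝕜 G]

/-- The linear map on the algebraic tensor product induced by a bounded bilinear map. -/
def projLiftAlg (B : E →L[𝕜] F →L[𝕜] G) : ProjectiveAlg 𝕜 E F →L[𝕜] G :=
  LinearMap.mkContinuous
    (TensorProduct.lift B.toLinearMap₁₂ : E ⊗[𝕜] F →ₗ[𝕜] G) ‖B‖ fun t => by
    have h : ∀ a ∈ projectiveSums (𝕜 := 𝕜) t,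
        ‖(TensorProduct.lift B.toLinearMap₁₂ : E ⊗[𝕜] F →ₗ[𝕜] G) t‖ ≤ ‖B‖ * a := by
      rintro _ ⟨n, x, y, rfl, rfl⟩
      rw [map_sum, Finset.mul_sum]
      refine norm_sum_le_of_le _ fun k _ => ?_
      rw [TensorProduct.lift.tmul, ← mul_assoc]
      exact B.le_opNorm₂ _ _
    change _ ≤ ‖B‖ * sInf (projectiveSums (𝕜 := 𝕜) t)
    rw [← smul_eq_mul, ← Real.sInf_smul_of_nonneg (norm_nonneg B)]
    refine le_csInf ((projectiveSums_nonempty (𝕜 := 𝕜) t).image _) ?_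
    rintro _ ⟨a, ha, rfl⟩
    exact h a ha

/-- The bounded linear map on the projective tensor product induced by a bounded bilinear map:
the extension by continuity of the induced map on the algebraic tensor product. -/
def projLift [CompleteSpace G] (B : E →L[𝕜] F →L[𝕜] G) : ProjectiveTensor 𝕜 E F →L[𝕜] G :=
  (projLiftAlg B).extend UniformSpace.Completion.toComplL

theorem projLift_tmul [CompleteSpace G] (B : E →L[𝕜] F →L[𝕜] G) (x : E) (y : F) :
    projLift B (projTmul 𝕜 x y) = B x y :=
  (ContinuousLinearMap.extend_eq (projLiftAlg B)
    (e := (UniformSpace.Completion.toComplL : ProjectiveAlg 𝕜 E F →L[𝕜] _))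
    UniformSpace.Completion.denseRange_coe
    (UniformSpace.Completion.isUniformInducing_coe _) (x ⊗ₜ[𝕜] y : E ⊗[𝕜] F)).trans
    (TensorProduct.lift.tmul _ _)

end Projective

section Cross

variable (H : Type*) [NormedAddCommGroup H] [InnerProductSpace ℂ H] [CompleteSpace H]
variable (J : Type*) [NormedAddCommGroup J] [InnerProductSpace ℂ J] [CompleteSpace J]

/-- The immersion map of the projective tensor product of the trace classes in the trace class of
the tensor product Hilbert space: the continuous extension of `S ⊗ T ↦ S ⊗ T`. -/
def immersion : ProjectiveTensor ℂ (TraceClass H) (TraceClass J) →L[ℂ]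
    TraceClass (HilbertTensor H J) :=
  projLift TraceClass.tensorBilin

/-- The immersion map of the real projective tensor product of the self-adjoint trace classes. -/
def immersionSA : ProjectiveTensor ℝ (TraceClassSA H) (TraceClassSA J) →L[ℝ]
    TraceClassSA (HilbertTensor H J) :=
  projLift TraceClassSA.tensorBilin

/-- The cross trace class operators: the range of the immersion map. -/
def crossTraceClass : Submodule ℂ (TraceClass (HilbertTensor H J)) :=
  LinearMap.range (immersion H J).toLinearMap

/-- The self-adjoint cross trace class operators: the range of the real immersion map. -/
def crossTraceClassSA : Submodule ℝ (TraceClassSA (HilbertTensor H J)) :=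
  LinearMap.range (immersionSA H J).toLinearMap

variable {H J}

/-- A standard decomposition `C = ∑ r_k (X_k ⊗ Y_k)`, with `r_k ≥ 0`, `∑ r_k < ∞` and
`‖X_k‖₁ ‖Y_k‖₁ = 1`; the sum converges in the trace norm. -/
structure IsStandardDecomposition {ι : Type} (C : TraceClass (HilbertTensor H J)) (r : ι → ℝ)
    (X : ι → TraceClass H) (Y : ι → TraceClass J) : Prop where
  nonneg : ∀ k, 0 ≤ r k
  summable : Summable r
  norm_mul_norm : ∀ k, ‖X k‖ * ‖Y k‖ = 1
  hasSum : HasSum (fun k => r k • TraceClass.tensor (X k) (Y k)) C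

/-- A standard decomposition with self-adjoint `X_k` and `Y_k`. -/
structure IsHermitianStandardDecomposition {ι : Type} (C : TraceClassSA (HilbertTensor H J))
    (r : ι → ℝ) (X : ι → TraceClassSA H) (Y : ι → TraceClassSA J) : Prop where
  nonneg : ∀ k, 0 ≤ r k
  summable : Summable r
  norm_mul_norm : ∀ k, ‖X k‖ * ‖Y k‖ = 1
  hasSum : HasSum (fun k => r k • TraceClassSA.tensor (X k) (Y k)) C

/-- A rank-one partial isometry `x ↦ ⟪φ, x⟫ η`, with unit vectors `η` and `φ`. -/
def IsRankOnePartialIsometry (X : TraceClass H) : Prop :=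
  ∃ η φ : H, ‖η‖ = 1 ∧ ‖φ‖ = 1 ∧ X.toCLM = InnerProductSpace.rankOne ℂ η φ

/-- The values `∑ r_k` of all finite or countably infinite standard decompositions of `C`. -/
def standardSums (C : TraceClass (HilbertTensor H J)) : Set ℝ :=
  {s | ∃ (ι : Type) (_ : Countable ι) (r : ι → ℝ) (X : ι → TraceClass H) (Y : ι → TraceClass J),
    IsStandardDecomposition C r X Y ∧ s = ∑' k, r k}

/-- The values `∑ r_k` of the standard decompositions of `C` in which the `X_k` and `Y_k` are
rank-one partial isometries. -/
def rankOneStandardSums (C : TraceClass (HilbertTensor H J)) : Set ℝ :=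
  {s | ∃ (ι : Type) (_ : Countable ι) (r : ι → ℝ) (X : ι → TraceClass H) (Y : ι → TraceClass J),
    IsStandardDecomposition C r X Y ∧
    (∀ k, IsRankOnePartialIsometry (X k) ∧ IsRankOnePartialIsometry (Y k)) ∧ s = ∑' k, r k}

/-- The values `∑ r_k` of all finite or countably infinite Hermitian standard decompositions. -/
def hermitianStandardSums (C : TraceClassSA (HilbertTensor H J)) : Set ℝ :=
  {s | ∃ (ι : Type) (_ : Countable ι) (r : ι → ℝ) (X : ι → TraceClassSA H)
    (Y : ι → TraceClassSA J), IsHermitianStandardDecomposition C r X Y ∧ s = ∑' k, r k}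

/-- The projective norm of a cross trace class operator: the infimum of `∑ r_k` over its standard
decompositions. -/
def crossNorm (C : TraceClass (HilbertTensor H J)) : ℝ := sInf (standardSums C)

/-- The Hermitian projective norm of a self-adjoint cross trace class operator. -/
def crossNormSA (C : TraceClassSA (HilbertTensor H J)) : ℝ := sInf (hermitianStandardSums C)

end Cross

section Renormed

/-- The vector space `V`, with the function `N` as its norm. -/
def Renormed {𝕜 E : Type*} [Ring 𝕜] [AddCommGroup E] [Module 𝕜 E] (V : Submodule 𝕜 E)
    (_N : E → ℝ) : Type _ := V

variable {𝕜 E : Type*} [Ring 𝕜] [AddCommGroup E] [Module 𝕜 E] (V : Submodule 𝕜 E) (N : E → ℝ)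

instance : AddCommGroup (Renormed V N) := inferInstanceAs (AddCommGroup V)
instance : Module 𝕜 (Renormed V N) := inferInstanceAs (Module 𝕜 V)
instance : Norm (Renormed V N) := ⟨fun v => N v.1⟩

/-- `V` is a separable Banach space over `𝕜`: its norm function satisfies the axioms of a norm, and
the resulting normed space is complete and separable. -/
structure IsSeparableBanachSpace (𝕜 V : Type*) [NormedField 𝕜] [AddCommGroup V] [Module 𝕜 V]
    [Norm V] : Prop where
  core : NormedSpace.Core 𝕜 V
  complete : letI := NormedAddCommGroup.ofCore core; CompleteSpace V
  separable : letI := NormedAddCommGroup.ofCore core; TopologicalSpace.SeparableSpace V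

end Renormed

end CrossTrace

end

/-! Two facts about the projective tensor product carry the theorem. The first is that `immersion`
and `immersionSA` are injective. The second is that every `u` is the sum of a series `∑ r_k (X_k ⊗
Y_k)` in the projective tensor product, with `X_k ⊗ Y_k` from a prescribed set of atoms and `∑ r_k ≤
‖u‖ + ε`. The immersion maps such a series to a standard decomposition. Conversely a standard
decomposition of `C` lifts to an absolutely convergent series of norm at most `∑ r_k`
(`exists_projLift_eq_of_hasSum`), and by injectivity its sum is the only preimage of `C`. Hence the
infimum of `∑ r_k` is the projective norm of the preimage (`crossNorm_immersion`,
`crossNormSA_immersionSA`); completeness, separability and both kinds of convergence are transported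
from there.

Injectivity (`projLift_injective`) rests on a contractive approximate identity of finite rank. The
compressions `A ↦ P_F A P_F` to finite parts of a Hilbert basis converge strongly on the trace
class. Their tensor products factor through the immersion, since a product of matrix coefficients is
a matrix coefficient of `S ⊗ T`. So they annihilate the kernel of the immersion and yet tend to the
identity.

The series come from the cone of pairs `(x, m)` in which `x` is a nonnegative combination of atoms
of weight at most `m`. If `(x, ‖x‖)` lies in its closure for all `x`, successive approximation gives
the series (`exists_hasSum_of_closedAtomicCone`). This property passes from two spaces to their
projective tensor product (`norm_mem_closedAtomicCone_projective`). For the trace class with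
rank-one partial isometries it follows from an approximate polar decomposition and the expansion of
`|A| = R R` along a basis (`TraceClass.norm_mem_closedAtomicCone`).

The self-adjoint elements are identified by `Re (X ⊗ Y) = Re X ⊗ Re Y - Im X ⊗ Im Y`, applied
termwise. Submultiplicativity comes from multiplying two nearly optimal decompositions term by term.
-/

namespace CrossTrace

/-! ### Hilbert–Schmidt estimates and finite basis projections -/

section HilbertSchmidt

variable {H : Type*} [NormedAddCommGroup H] [InnerProductSpace ℂ H] [CompleteSpace H]
variable {ι : Type*}

theorem hs_star (b : HilbertBasis ι ℂ H) (T : H →L[ℂ] H) :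
    ∑' i, ‖star T (b i)‖ₑ ^ 2 = ∑' i, ‖T (b i)‖ₑ ^ 2 :=
  (hs_adjoint b b T).symm

/-- The Hölder inequality for Hilbert–Schmidt operators. -/
theorem traceENorm_mul_le_hs (b : HilbertBasis ι ℂ H) (S T : H →L[ℂ] H) :
    traceENorm (S * T) ≤
      (∑' i, ‖S (b i)‖ₑ ^ 2) ^ (1 / 2 : ℝ) * (∑' i, ‖T (b i)‖ₑ ^ 2) ^ (1 / 2 : ℝ) := by
  refine traceENorm_le b _ _ fun L hL F => ?_
  have hterm : ∀ i, ‖⟪b i, (L * (S * T)) (b i)⟫_ℂ‖ₑ ≤ ‖star (L * S) (b i)‖ₑ * ‖T (b i)‖ₑ := by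
    intro i
    rw [← mul_assoc, mul_apply_eq_comp, ← ContinuousLinearMap.adjoint_inner_left,
      ← ContinuousLinearMap.star_eq_adjoint, ← ofReal_norm, ← ofReal_norm, ← ofReal_norm,
      ← ENNReal.ofReal_mul (norm_nonneg _)]
    exact ENNReal.ofReal_le_ofReal (norm_inner_le_norm _ _)
  refine (Finset.sum_le_sum fun i _ => hterm i).trans ?_
  refine (ENNReal.inner_le_Lp_mul_Lq F _ _ Real.HolderConjugate.two_two).trans ?_
  simp only [ENNReal.rpow_ofNat]
  gcongr
  · refine (ENNReal.sum_le_tsum F).trans ?_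
    rw [hs_star b]
    exact hs_contraction_left b S L hL
  · exact ENNReal.sum_le_tsum F

/-- The moduli of `A * M` and `R * (R * M)` agree, because `star A * A = R ^ 4`. The Hölder
inequality therefore applies without a polar decomposition of `A`. -/
theorem hs_abs_root (b : HilbertBasis ι ℂ H) {A R : H →L[ℂ] H} (hR : IsSelfAdjoint R)
    (h : R * R = CFC.abs A) (M : H →L[ℂ] H) :
    traceENorm (A * M) ≤
      traceENorm A ^ (1 / 2 : ℝ) * (∑' i, ‖(R * M) (b i)‖ₑ ^ 2) ^ (1 / 2 : ℝ) := by
  have h1 : CFC.abs (A * M) = CFC.abs (R * (R * M)) := by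
    have h2 : star (A * M) * (A * M) = star (R * (R * M)) * (R * (R * M)) := by
      calc star (A * M) * (A * M) = star M * (star A * A) * M := by
            simp only [star_mul, mul_assoc]
        _ = star M * (R * R * (R * R)) * M := by rw [h, CFC.abs_mul_abs]
        _ = _ := by simp only [star_mul, mul_assoc, hR.star_eq]
    rw [CFC.abs, CFC.abs, h2]
  have h2 : traceENorm (A * M) = traceENorm (R * (R * M)) := by
    rw [traceENorm, traceENorm, h1]
  rw [h2, traceENorm_eq_hs b A R hR h]
  exact traceENorm_mul_le_hs b _ _

/-- The orthogonal projection on the span of finitely many members of a Hilbert basis. -/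
noncomputable def basisProj (b : HilbertBasis ι ℂ H) (F : Finset ι) : H →L[ℂ] H :=
  ∑ i ∈ F, InnerProductSpace.rankOne ℂ (b i) (b i)

theorem basisProj_apply (b : HilbertBasis ι ℂ H) (F : Finset ι) (x : H) :
    basisProj b F x = ∑ i ∈ F, ⟪b i, x⟫_ℂ • b i := by
  simp [basisProj]

theorem star_basisProj (b : HilbertBasis ι ℂ H) (F : Finset ι) :
    star (basisProj b F) = basisProj b F := by
  simp [basisProj, ContinuousLinearMap.star_eq_adjoint]

open Classical in
theorem basisProj_basis (b : HilbertBasis ι ℂ H) (F : Finset ι) (i : ι) :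
    basisProj b F (b i) = if i ∈ F then b i else 0 := by
  simp [basisProj_apply, orthonormal_iff_ite.mp b.orthonormal]

theorem norm_basisProj_le (b : HilbertBasis ι ℂ H) (F : Finset ι) : ‖basisProj b F‖ ≤ 1 := by
  refine IsStarProjection.norm_le _ ⟨?_, star_basisProj b F⟩
  ext x
  classical
  rw [mul_apply_eq_comp, basisProj_apply b F x, map_sum]
  refine Finset.sum_congr rfl fun i hi => ?_
  rw [map_smul, basisProj_basis, if_pos hi]

-- The operator `R * (1 - basisProj b F)` kills `b i` for `i ∈ F` and agrees with `R` on the other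
-- basis vectors, so the sum is the tail of a convergent series.
open Filter Topology in
theorem tendsto_hs_sub_basisProj (b : HilbertBasis ι ℂ H) (R : H →L[ℂ] H)
    (hR : ∑' i, ‖R (b i)‖ₑ ^ 2 ≠ ⊤) :
    Tendsto (fun F => ∑' i, ‖(R * (1 - basisProj b F)) (b i)‖ₑ ^ 2) atTop (𝓝 0) := by
  classical
  refine (ENNReal.tendsto_tsum_compl_atTop_zero hR).congr fun F => ?_
  refine (tsum_subtype {i | i ∉ F} fun i => ‖R (b i)‖ₑ ^ 2).trans ?_
  refine tsum_congr fun i => ?_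
  by_cases h : i ∈ F <;> simp [basisProj_basis, h]

open Filter Topology in
theorem tendsto_rpow_half_zero {α : Type*} {l : Filter α} {f : α → ℝ≥0∞} (a : ℝ≥0∞) (ha : a ≠ ⊤)
    (hf : Tendsto f l (𝓝 0)) :
    Tendsto (fun x => a ^ (1 / 2 : ℝ) * f x ^ (1 / 2 : ℝ)) l (𝓝 0) := by
  have h1 : Tendsto (fun x => f x ^ (1 / 2 : ℝ)) l (𝓝 0) := by
    have := hf.ennrpow_const (1 / 2 : ℝ)
    rwa [ENNReal.zero_rpow_of_pos (by norm_num)] at this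
  simpa using ENNReal.Tendsto.const_mul h1 (Or.inr (ENNReal.rpow_ne_top_of_nonneg (by norm_num) ha))

end HilbertSchmidt

/-! ### Trace norm approximation by finite-rank compressions -/

namespace TraceClass

variable {H : Type*} [NormedAddCommGroup H] [InnerProductSpace ℂ H] [CompleteSpace H]
variable {ι : Type*}

open Filter Topology

theorem norm_le_of_traceENorm_le {A : TraceClass H} {m : ℝ} (hm : 0 ≤ m)
    (h : traceENorm A.toCLM ≤ ENNReal.ofReal m) : ‖A‖ ≤ m := by
  rwa [← ofReal_norm_eq, ENNReal.ofReal_le_ofReal_iff hm] at h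

theorem tendsto_of_traceENorm {α : Type*} {l : Filter α} {u : α → TraceClass H} {A : TraceClass H}
    (h : Tendsto (fun a => traceENorm (A - u a).toCLM) l (𝓝 0)) : Tendsto u l (𝓝 A) := by
  rw [tendsto_iff_norm_sub_tendsto_zero]
  have := (ENNReal.tendsto_toReal ENNReal.zero_ne_top).comp h
  refine this.congr fun a => ?_
  rw [norm_sub_rev]
  rfl

theorem norm_mul_le (A B : TraceClass H) : ‖A * B‖ ≤ ‖A‖ * ‖B‖ := by
  refine norm_le_of_traceENorm_le (by positivity) ((traceENorm_mul_le A.toCLM B.toCLM).trans ?_)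
  rw [ENNReal.ofReal_mul (norm_nonneg _), ← ofReal_norm_eq B, ← ofReal_norm A.toCLM]
  gcongr
  exact opNorm_le A

theorem traceENorm_mul_le_right (A B : H →L[ℂ] H) :
    traceENorm (A * B) ≤ traceENorm A * ‖B‖ₑ := by
  have h := traceENorm_mul_le (star B) (star A)
  rw [← star_mul, traceENorm_star, traceENorm_star] at h
  rwa [mul_comm, ← ofReal_norm, ← norm_star, ofReal_norm]

theorem traceENorm_mul_mul_le (S A T : H →L[ℂ] H) :
    traceENorm (S * A * T) ≤ ‖S‖ₑ * traceENorm A * ‖T‖ₑ :=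
  (traceENorm_mul_le_right _ _).trans (mul_le_mul_left (traceENorm_mul_le _ _) _)

/-- Two-sided multiplication of trace class operators by bounded operators. -/
noncomputable def conj (S T : H →L[ℂ] H) : TraceClass H →L[ℂ] TraceClass H :=
  LinearMap.mkContinuous
    { toFun := fun A => mk (S * A.toCLM * T) ((traceENorm_mul_mul_le _ _ _).trans_lt
        (ENNReal.mul_lt_top (ENNReal.mul_lt_top enorm_lt_top A.traceENorm_lt_top) enorm_lt_top))
      map_add' := fun A B => by ext1; simp [mul_add, add_mul]
      map_smul' := fun c A => by ext1; simp }
    (‖S‖ * ‖T‖) fun A => by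
      refine norm_le_of_traceENorm_le (by positivity) ((traceENorm_mul_mul_le _ _ _).trans_eq ?_)
      rw [ENNReal.ofReal_mul (by positivity), ENNReal.ofReal_mul (norm_nonneg _), ofReal_norm_eq,
        ofReal_norm, ofReal_norm]
      ring

@[simp] theorem toCLM_conj (S T : H →L[ℂ] H) (A : TraceClass H) :
    (conj S T A).toCLM = S * A.toCLM * T := rfl

theorem norm_conj_le (S T : H →L[ℂ] H) (A : TraceClass H) : ‖conj S T A‖ ≤ ‖S‖ * ‖T‖ * ‖A‖ :=
  ContinuousLinearMap.le_of_opNorm_le _ (LinearMap.mkContinuous_norm_le _ (by positivity) _) A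

theorem norm_conj_le_of_le_one {S T : H →L[ℂ] H} (hS : ‖S‖ ≤ 1) (hT : ‖T‖ ≤ 1)
    (A : TraceClass H) : ‖conj S T A‖ ≤ ‖A‖ :=
  (norm_conj_le S T A).trans (mul_le_of_le_one_left (norm_nonneg _)
    (mul_le_one₀ hS (norm_nonneg _) hT))

/-- The difference is `A (1 - P)`, whose trace norm `hs_abs_root` bounds by `‖A‖₁ ^ (1/2)` times the
Hilbert–Schmidt norm of `R (1 - P)`. -/
theorem tendsto_mul_basisProj (b : HilbertBasis ι ℂ H) (A : TraceClass H) :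
    Tendsto (fun F => conj 1 (basisProj b F) A) atTop (𝓝 A) := by
  obtain ⟨R, hR, hRA⟩ := abs_eq_sq A.toCLM
  refine tendsto_of_traceENorm ?_
  have h1 : ∑' i, ‖R (b i)‖ₑ ^ 2 ≠ ⊤ :=
    (traceENorm_eq_hs b A.toCLM R hR hRA).symm.trans_ne A.traceENorm_lt_top.ne
  refine tendsto_of_tendsto_of_tendsto_of_le_of_le tendsto_const_nhds
    (tendsto_rpow_half_zero _ A.traceENorm_lt_top.ne (tendsto_hs_sub_basisProj b R h1))
    (fun _ => zero_le) fun F => ?_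
  have h2 : (A - conj 1 (basisProj b F) A).toCLM = A.toCLM * (1 - basisProj b F) := by
    rw [toCLM_sub, toCLM_conj, one_mul, mul_sub, mul_one]
  rw [h2]
  exact hs_abs_root b hR hRA _

theorem tendsto_basisProj_conj (b : HilbertBasis ι ℂ H) (A : TraceClass H) :
    Tendsto (fun F => conj (basisProj b F) (basisProj b F) A) atTop (𝓝 A) := by
  have h1 := tendsto_iff_norm_sub_tendsto_zero.mp (tendsto_mul_basisProj b A)
  have h2 := tendsto_iff_norm_sub_tendsto_zero.mp (tendsto_mul_basisProj b (star A))
  rw [tendsto_iff_norm_sub_tendsto_zero]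
  refine squeeze_zero (fun _ => norm_nonneg _) (fun F => ?_) (by simpa using h2.add h1)
  -- The identity `PAP - A = (A⋆P - A⋆)⋆ + P(AP - A)` reduces the two-sided limit to one-sided
  -- limits for `A⋆` and `A`.
  have e1 : conj (basisProj b F) (basisProj b F) A - A =
      star (conj 1 (basisProj b F) (star A) - star A) +
        conj (basisProj b F) 1 (conj 1 (basisProj b F) A - A) := by
    ext1
    simp [star_basisProj]
    noncomm_ring
  rw [e1]
  refine (norm_add_le _ _).trans (add_le_add (norm_star _).le ?_)
  exact norm_conj_le_of_le_one (norm_basisProj_le b F) ContinuousLinearMap.norm_id_le _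

/-- The lower bound holds because the operator norm is dominated by the trace norm. The upper bound
is Cauchy–Schwarz and Bessel for the coefficients of `L η` and `φ`. -/
theorem traceENorm_rankOne (η φ : H) :
    traceENorm (InnerProductSpace.rankOne ℂ η φ) = ‖η‖ₑ * ‖φ‖ₑ := by
  refine le_antisymm ?_ ((InnerProductSpace.enorm_rankOne η φ).symm.le.trans (enorm_le_traceENorm _))
  obtain ⟨w, b, -⟩ := exists_hilbertBasis ℂ H
  refine traceENorm_le b _ _ fun L hL F => ?_
  have hterm : ∀ i, ‖⟪b i, (L * InnerProductSpace.rankOne ℂ η φ) (b i)⟫_ℂ‖ₑ =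
      ‖⟪b i, L η⟫_ℂ‖ₑ * ‖⟪b i, φ⟫_ℂ‖ₑ := by
    intro i
    rw [mul_apply_eq_comp, InnerProductSpace.rankOne_apply, map_smul, inner_smul_right, enorm_mul,
      mul_comm, ← inner_conj_symm φ, RCLike.enorm_conj]
  simp_rw [hterm]
  refine (ENNReal.inner_le_Lp_mul_Lq F _ _ Real.HolderConjugate.two_two).trans ?_
  have hsq : ∀ x : H, (∑ i ∈ F, ‖⟪b i, x⟫_ℂ‖ₑ ^ (2 : ℝ)) ^ (1 / 2 : ℝ) ≤ ‖x‖ₑ := by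
    intro x
    rw [one_div, ENNReal.rpow_inv_le_iff (by norm_num)]
    simp only [ENNReal.rpow_ofNat]
    exact (ENNReal.sum_le_tsum F).trans (parseval b x).le
  refine mul_le_mul' ((hsq _).trans ?_) (hsq _)
  rw [← ofReal_norm, ← ofReal_norm]
  exact ENNReal.ofReal_le_ofReal ((L.le_of_opNorm_le hL η).trans_eq (one_mul _))

/-- The rank-one operator `x ↦ ⟪φ, x⟫ η`, as a trace class operator. -/
noncomputable def rankOne (η φ : H) : TraceClass H :=
  mk (InnerProductSpace.rankOne ℂ η φ) (by
    rw [traceENorm_rankOne]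
    exact ENNReal.mul_lt_top enorm_lt_top enorm_lt_top)

@[simp] theorem toCLM_rankOne (η φ : H) :
    (rankOne η φ).toCLM = InnerProductSpace.rankOne ℂ η φ := rfl

theorem norm_rankOne (η φ : H) : ‖rankOne η φ‖ = ‖η‖ * ‖φ‖ := by
  rw [norm_def, toCLM_rankOne, traceENorm_rankOne, ENNReal.toReal_mul, toReal_enorm, toReal_enorm]

/-- This exhibits a compression as a finite-rank map with matrix coefficients as its coordinate
functionals, the form that injectivity and separability require. -/
theorem conj_basisProj_eq_sum (b : HilbertBasis ι ℂ H) (F : Finset ι) (A : TraceClass H) :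
    conj (basisProj b F) (basisProj b F) A =
      ∑ p ∈ F ×ˢ F, ⟪b p.1, A.toCLM (b p.2)⟫_ℂ • rankOne (b p.1) (b p.2) := by
  -- `toCLM` is a bare function, so an additive homomorphism is built from it to commute with finite
  -- sums.
  have hsum : ∀ (s : Finset (ι × ι)) (f : ι × ι → TraceClass H),
      (∑ p ∈ s, f p).toCLM = ∑ p ∈ s, (f p).toCLM := fun s f =>
    map_sum (⟨⟨toCLM, rfl⟩, fun _ _ => rfl⟩ : TraceClass H →+ (H →L[ℂ] H)) f s
  ext1
  rw [hsum]
  ext x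
  rw [toCLM_conj, mul_apply_eq_comp, mul_apply_eq_comp, basisProj_apply b F x, map_sum, map_sum,
    sum_apply, Finset.sum_product_right]
  refine Finset.sum_congr rfl fun j _ => ?_
  rw [map_smul, map_smul, basisProj_apply, Finset.smul_sum]
  refine Finset.sum_congr rfl fun i _ => ?_
  simp [smul_smul, mul_comm]

end TraceClass

/-! ### Atomic cones and series of atoms -/

section AtomicCone

variable {E : Type*} [NormedAddCommGroup E] [NormedSpace ℝ E]

/-- The convex cone of the pairs `(x, m)` such that `x` is a finite nonnegative combination of
members of `S` of total weight at most `m`. -/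
def atomicCone (S : Set E) : Submodule ℝ≥0 (E × ℝ) :=
  Submodule.span ℝ≥0 (insert (0, 1) ((fun s => (s, 1)) '' S))

theorem nnreal_smul_prod (c : ℝ≥0) (p : E × ℝ) : c • p = ((c : ℝ) • p.1, (c : ℝ) * p.2) := rfl

theorem mem_atomicCone_of_mem {S : Set E} {s : E} (hs : s ∈ S) : (s, 1) ∈ atomicCone S :=
  Submodule.subset_span (Set.mem_insert_of_mem _ (Set.mem_image_of_mem _ hs))

theorem zero_one_mem_atomicCone (S : Set E) : (0, 1) ∈ atomicCone S :=
  Submodule.subset_span (Set.mem_insert _ _)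

theorem smul_mem_atomicCone {S : Set E} {s : E} (hs : s ∈ S) {r : ℝ} (hr : 0 ≤ r) :
    (r • s, r) ∈ atomicCone S := by
  lift r to ℝ≥0 using hr
  have h := (atomicCone S).smul_mem r (mem_atomicCone_of_mem hs)
  rw [nnreal_smul_prod] at h
  simpa using h

/-- This is the purpose of the generator `(0, 1)`: it adds weight without changing the vector. -/
theorem atomicCone_mono_right {S : Set E} {x : E} {m m' : ℝ} (h : (x, m) ∈ atomicCone S)
    (hm : m ≤ m') : (x, m') ∈ atomicCone S := by
  obtain ⟨d, rfl⟩ : ∃ d : ℝ≥0, m + d = m' := 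
    ⟨(m' - m).toNNReal, by rw [Real.coe_toNNReal _ (sub_nonneg.mpr hm)]; ring⟩
  have h1 := (atomicCone S).add_mem h ((atomicCone S).smul_mem d (zero_one_mem_atomicCone S))
  rw [nnreal_smul_prod] at h1
  simpa using h1

theorem exists_of_mem_atomicCone {S : Set E} {p : E × ℝ} (h : p ∈ atomicCone S) :
    ∃ (n : ℕ) (r : Fin n → ℝ) (s : Fin n → E), (∀ k, 0 ≤ r k) ∧ (∀ k, s k ∈ S) ∧
      ∑ k, r k • s k = p.1 ∧ ∑ k, r k ≤ p.2 := by
  induction h using Submodule.span_induction with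
  | mem p hp =>
    rcases hp with rfl | ⟨s, hs, rfl⟩
    · exact ⟨0, Fin.elim0, Fin.elim0, by simp, by simp, by simp, by simp⟩
    · exact ⟨1, fun _ => 1, fun _ => s, by simp, by simp [hs], by simp, by simp⟩
  | zero => exact ⟨0, Fin.elim0, Fin.elim0, by simp, by simp, by simp, by simp⟩
  | add p q _ _ hp hq =>
    obtain ⟨n, r, s, h1, h2, h3, h4⟩ := hp
    obtain ⟨n', r', s', h1', h2', h3', h4'⟩ := hq
    refine ⟨n + n', Fin.append r r', Fin.append s s', fun k => ?_, fun k => ?_, ?_, ?_⟩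
    · induction k using Fin.addCases <;> simp [h1, h1']
    · induction k using Fin.addCases <;> simp [h2, h2']
    · simp [Fin.sum_univ_add, h3, h3']
    · simpa [Fin.sum_univ_add] using add_le_add h4 h4'
  | smul c p _ hp =>
    obtain ⟨n, r, s, h1, h2, h3, h4⟩ := hp
    refine ⟨n, fun k => c * r k, s, fun k => mul_nonneg c.2 (h1 k), h2, ?_, ?_⟩
    · simp [mul_smul, ← Finset.smul_sum, h3, NNReal.smul_def]
    · rw [← Finset.mul_sum]
      exact mul_le_mul_of_nonneg_left h4 c.2

/-- The closure of `atomicCone S`. -/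
def closedAtomicCone (S : Set E) : Submodule ℝ≥0 (E × ℝ) := (atomicCone S).topologicalClosure

theorem isClosed_closedAtomicCone (S : Set E) : IsClosed (closedAtomicCone S : Set (E × ℝ)) :=
  Submodule.isClosed_topologicalClosure _

theorem atomicCone_le_closed (S : Set E) : atomicCone S ≤ closedAtomicCone S :=
  Submodule.le_topologicalClosure _

/-- Normalise the vector. In the Hermitian case the atoms are only required to have norm one, so
this replaces the rank-one approximation. -/
theorem norm_mem_atomicCone_sphere (x : E) : (x, ‖x‖) ∈ atomicCone {s : E | ‖s‖ = 1} := by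
  by_cases hx : x = 0
  · rw [hx, norm_zero]; exact (atomicCone _).zero_mem
  · have hx' : ‖x‖ ≠ 0 := norm_ne_zero_iff.mpr hx
    have h := smul_mem_atomicCone (S := {s : E | ‖s‖ = 1}) (s := ‖x‖⁻¹ • x)
      (by simp [norm_smul, hx']) (norm_nonneg x)
    rwa [smul_smul, mul_inv_cancel₀ hx', one_smul] at h

/-- The product carries the maximum metric, so one nearby point of the cone controls the vector and
the weight at once. -/
theorem exists_approx_of_mem_closedAtomicCone {S : Set E} {x : E}
    (h : (x, ‖x‖) ∈ closedAtomicCone S) {δ : ℝ} (hδ : 0 < δ) :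
    ∃ (n : ℕ) (r : Fin n → ℝ) (s : Fin n → E), (∀ k, 0 ≤ r k) ∧ (∀ k, s k ∈ S) ∧
      ‖x - ∑ k, r k • s k‖ ≤ δ ∧ ∑ k, r k ≤ ‖x‖ + δ := by
  obtain ⟨p, hp, hd⟩ := Metric.mem_closure_iff.mp h δ hδ
  obtain ⟨n, r, s, h1, h2, h3, h4⟩ := exists_of_mem_atomicCone hp
  rw [Prod.dist_eq, max_lt_iff, dist_eq_norm, Real.dist_eq, abs_sub_lt_iff] at hd
  refine ⟨n, r, s, h1, h2, ?_, by linarith⟩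
  rw [h3]
  exact hd.1.le

/-- If every vector is a limit of finite nonnegative combinations of `S` with weight close to its
norm, then it is the sum of a series of that kind. -/
theorem exists_hasSum_of_closedAtomicCone [CompleteSpace E] {S : Set E} (hS : ∀ s ∈ S, ‖s‖ ≤ 1)
    (h : ∀ x : E, (x, ‖x‖) ∈ closedAtomicCone S) (x : E) {ε : ℝ} (hε : 0 < ε) :
    ∃ (ι : Type) (_ : Countable ι) (r : ι → ℝ) (s : ι → E), (∀ k, 0 ≤ r k) ∧ (∀ k, s k ∈ S) ∧
      Summable r ∧ HasSum (fun k => r k • s k) x ∧ ∑' k, r k ≤ ‖x‖ + ε := by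
  -- Tolerances of total `ε / 2`: each is spent twice, once as a bound for the next residual and
  -- once as excess weight.
  set d : ℕ → ℝ := fun n => ε / 2 / 2 / 2 ^ n with hd
  have hd0 : ∀ n, 0 < d n := fun n => by positivity
  have hdsum : HasSum d (ε / 2) := hasSum_geometric_two' _
  choose N r s hr hs happ hm using fun (y : E) (n : ℕ) =>
    exists_approx_of_mem_closedAtomicCone (h y) (hd0 n)
  -- Residuals: at stage `n` an approximant of `X n` within `d n` is subtracted.
  let X : ℕ → E := fun n => Nat.rec x (fun n y => y - ∑ k, r y n k • s y n k) n
  have hX0 : X 0 = x := rfl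
  have hXs : ∀ n, X (n + 1) = X n - ∑ k, r (X n) n k • s (X n) n k := fun n => rfl
  have hXn : ∀ n, ‖X (n + 1)‖ ≤ d n := fun n => by rw [hXs]; exact happ _ _
  set m : ℕ → ℝ := fun n => ∑ k, r (X n) n k with hmdef
  -- Stage `n + 1` costs at most `‖X (n + 1)‖ + d (n + 1)`, and the residual has norm at most `d n`.
  have hm0 : ∀ n, 0 ≤ m n := fun n => Finset.sum_nonneg fun k _ => hr _ _ k
  have hmle : ∀ n, m (n + 1) ≤ d n + d (n + 1) := fun n =>
    (hm _ _).trans (add_le_add_left (hXn n) _)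
  have hd1 : Summable fun n => d (n + 1) := (summable_nat_add_iff 1).mpr hdsum.summable
  have hmsum : Summable m := (summable_nat_add_iff 1).mp
    (Summable.of_nonneg_of_le (fun n => hm0 (n + 1)) hmle (hdsum.summable.add hd1))
  -- The total is at most `(‖x‖ + d 0) + ε / 2 + (ε / 2 - d 0)`.
  have hmt : ∑' n, m n ≤ ‖x‖ + ε := by
    rw [hmsum.tsum_eq_zero_add]
    have h1 : ∑' n, m (n + 1) ≤ ∑' n, (d n + d (n + 1)) :=
      ((summable_nat_add_iff 1).mpr hmsum).tsum_le_tsum hmle (hdsum.summable.add hd1)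
    rw [hdsum.summable.tsum_add hd1] at h1
    have h2 := hdsum.summable.tsum_eq_zero_add
    have h3 : m 0 ≤ ‖x‖ + d 0 := hm _ _
    rw [hdsum.tsum_eq] at h1 h2
    linarith
  let r' : (Σ n, Fin (N (X n) n)) → ℝ := fun p => r (X p.1) p.1 p.2
  let s' : (Σ n, Fin (N (X n) n)) → E := fun p => s (X p.1) p.1 p.2
  have hr' : ∀ p, 0 ≤ r' p := fun p => hr _ _ _
  have hrs : Summable r' := by
    rw [summable_sigma_of_nonneg hr']
    refine ⟨fun n => Summable.of_finite, ?_⟩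
    simpa only [tsum_fintype] using hmsum
  have hrsum : ∑' p, r' p = ∑' n, m n := by
    rw [hrs.tsum_sigma]
    simp only [tsum_fintype]
    rfl
  have hsum : Summable fun p => r' p • s' p := by
    refine Summable.of_norm_bounded hrs fun p => ?_
    rw [norm_smul, Real.norm_of_nonneg (hr' p)]
    exact mul_le_of_le_one_right (hr' p) (hS _ (hs _ _ _))
  refine ⟨_, inferInstance, r', s', hr', fun p => hs _ _ _, hrs, ?_, hrsum.trans_le hmt⟩
  -- The flattened series converges absolutely. Grouped by stages, its partial sums are `x - X n` by
  -- telescoping, so its sum is `x`.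
  have h1 : HasSum (fun n => ∑ k, r (X n) n k • s (X n) n k) (∑' p, r' p • s' p) :=
    hsum.hasSum.sigma fun n => hasSum_fintype _
  have h2 : ∀ n, ∑ i ∈ Finset.range n, ∑ k, r (X i) i k • s (X i) i k = x - X n := by
    intro n
    induction n with
    | zero => simp [hX0]
    | succ n ih => rw [Finset.sum_range_succ, ih, hXs]; abel
  have h3 : Filter.Tendsto X Filter.atTop (nhds 0) := by
    rw [← Filter.tendsto_add_atTop_iff_nat 1]
    exact squeeze_zero_norm hXn hdsum.summable.tendsto_atTop_zero
  have h4 := tendsto_nhds_unique h1.tendsto_sum_nat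
    (by simpa only [h2, sub_zero] using tendsto_const_nhds.sub h3)
  rw [← h4]
  exact hsum.hasSum

end AtomicCone

/-! ### Atomic cones under bilinear maps -/

section Bilinear

variable {E F G : Type*} [NormedAddCommGroup E] [NormedSpace ℝ E] [NormedAddCommGroup F]
  [NormedSpace ℝ F] [NormedAddCommGroup G] [NormedSpace ℝ G]

/-- The pairing `(x, m), (y, m') ↦ (B x y, m m')` is continuous, additive and `ℝ≥0`-homogeneous in
each variable, and maps pairs of generators to generators. It therefore maps cones into the cone,
and closures into its closure. -/
theorem bilinear_mem_closedAtomicCone (B : E →ₗ[ℝ] F →ₗ[ℝ] G)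
    (hB : Continuous fun p : E × F => B p.1 p.2) {S : Set E} {T : Set F} {U : Set G}
    (h : ∀ s ∈ S, ∀ t ∈ T, B s t ∈ U) {x : E} {y : F} {m m' : ℝ}
    (hx : (x, m) ∈ closedAtomicCone S) (hy : (y, m') ∈ closedAtomicCone T) :
    (B x y, m * m') ∈ closedAtomicCone U := by
  have hc : Continuous (Function.uncurry fun (p : E × ℝ) (q : F × ℝ) =>
      ((B p.1 q.1, p.2 * q.2) : G × ℝ)) := by
    refine Continuous.prodMk ?_ (by fun_prop)
    exact hB.comp ((continuous_fst.comp continuous_fst).prodMk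
      (continuous_fst.comp continuous_snd))
  refine map_mem_closure₂ (f := fun (p : E × ℝ) (q : F × ℝ) => (B p.1 q.1, p.2 * q.2)) hc hx hy
    fun p hp q hq => ?_
  change (B p.1 q.1, p.2 * q.2) ∈ atomicCone U
  induction hp using Submodule.span_induction with
  | zero => simp [← Prod.zero_eq_mk]
  | add p p' _ _ h1 h2 => simpa [add_mul] using (atomicCone U).add_mem h1 h2
  | smul c p _ h1 =>
    have := (atomicCone U).smul_mem c h1
    simpa [NNReal.smul_def, mul_assoc] using this
  | mem p hp =>
    induction hq using Submodule.span_induction with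
    | zero => simp [← Prod.zero_eq_mk]
    | add q q' _ _ h1 h2 => simpa [mul_add] using (atomicCone U).add_mem h1 h2
    | smul c q _ h1 =>
      have := (atomicCone U).smul_mem c h1
      simpa [NNReal.smul_def, mul_left_comm] using this
    | mem q hq =>
      -- If either generator is `(0, 1)`, the product is again `(0, 1)`.
      rcases hp with rfl | ⟨s, hs, rfl⟩
      · rcases hq with rfl | ⟨t, ht, rfl⟩ <;> simpa using zero_one_mem_atomicCone U
      · rcases hq with rfl | ⟨t, ht, rfl⟩
        · simpa using zero_one_mem_atomicCone U
        · simpa using mem_atomicCone_of_mem (h s hs t ht)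

end Bilinear

/-! ### The projective tensor product: universal map and atoms -/

section Projective

variable {𝕜 E F : Type*} [RCLike 𝕜] [NormedAddCommGroup E] [NormedSpace 𝕜 E]
  [NormedAddCommGroup F] [NormedSpace 𝕜 F]

theorem norm_coe_projectiveAlg (t : ProjectiveAlg 𝕜 E F) :
    ‖(t : ProjectiveTensor 𝕜 E F)‖ = sInf (projectiveSums (𝕜 := 𝕜) t) :=
  UniformSpace.Completion.norm_coe t

theorem projTmul_add_left (x x' : E) (y : F) :
    projTmul 𝕜 (x + x') y = projTmul 𝕜 x y + projTmul 𝕜 x' y := by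
  rw [projTmul, TensorProduct.add_tmul]
  exact UniformSpace.Completion.coe_add (α := ProjectiveAlg 𝕜 E F) _ _

theorem projTmul_add_right (x : E) (y y' : F) :
    projTmul 𝕜 x (y + y') = projTmul 𝕜 x y + projTmul 𝕜 x y' := by
  rw [projTmul, TensorProduct.tmul_add]
  exact UniformSpace.Completion.coe_add (α := ProjectiveAlg 𝕜 E F) _ _

theorem projTmul_smul_left (c : 𝕜) (x : E) (y : F) :
    projTmul 𝕜 (c • x) y = c • projTmul 𝕜 x y := by
  rw [projTmul, ← TensorProduct.smul_tmul']
  exact map_smul (UniformSpace.Completion.toComplL : ProjectiveAlg 𝕜 E F →L[𝕜] _) c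
    (x ⊗ₜ[𝕜] y : E ⊗[𝕜] F)

theorem projTmul_smul_right (c : 𝕜) (x : E) (y : F) :
    projTmul 𝕜 x (c • y) = c • projTmul 𝕜 x y := by
  rw [projTmul, TensorProduct.tmul_smul]
  exact map_smul (UniformSpace.Completion.toComplL : ProjectiveAlg 𝕜 E F →L[𝕜] _) c
    (x ⊗ₜ[𝕜] y : E ⊗[𝕜] F)

theorem norm_projTmul_le (x : E) (y : F) : ‖projTmul 𝕜 x y‖ ≤ ‖x‖ * ‖y‖ :=
  (norm_coe_projectiveAlg (𝕜 := 𝕜) (E := E) (F := F) _).trans_le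
    (csInf_le (projectiveSums_bddBelow _) ⟨1, fun _ => x, fun _ => y, by simp, by simp⟩)

variable (𝕜 E F) in
/-- The canonical bounded bilinear map to the projective tensor product. -/
noncomputable def projMk : E →L[𝕜] F →L[𝕜] ProjectiveTensor 𝕜 E F :=
  LinearMap.mkContinuous₂ (LinearMap.mk₂ 𝕜 (projTmul 𝕜) projTmul_add_left projTmul_smul_left
    projTmul_add_right projTmul_smul_right) 1 fun x y => by
      rw [one_mul]; exact norm_projTmul_le x y

@[simp] theorem projMk_apply (x : E) (y : F) : projMk 𝕜 E F x y = projTmul 𝕜 x y := rfl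

theorem continuous_projTmul : Continuous fun p : E × F => projTmul 𝕜 p.1 p.2 :=
  (projMk 𝕜 E F).continuous₂

theorem coe_projectiveAlg_sum {n : ℕ} (x : Fin n → E) (y : Fin n → F) :
    UniformSpace.Completion.coe' (α := ProjectiveAlg 𝕜 E F) (∑ k, x k ⊗ₜ[𝕜] y k : E ⊗[𝕜] F) =
      ∑ k, projTmul 𝕜 (x k) (y k) :=
  map_sum (UniformSpace.Completion.toComplL : ProjectiveAlg 𝕜 E F →L[𝕜] _)
    (fun k => (x k ⊗ₜ[𝕜] y k : E ⊗[𝕜] F)) Finset.univ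

/-- The algebraic tensor product is dense in its completion, and each of its elements is a finite
sum of simple tensors. -/
theorem projective_induction {p : ProjectiveTensor 𝕜 E F → Prop} (hc : IsClosed {u | p u})
    (h : ∀ (n : ℕ) (x : Fin n → E) (y : Fin n → F), p (∑ k, projTmul 𝕜 (x k) (y k)))
    (u : ProjectiveTensor 𝕜 E F) : p u := by
  refine UniformSpace.Completion.induction_on u hc fun t => ?_
  obtain ⟨a, n, x, y, ht, -⟩ := projectiveSums_nonempty (𝕜 := 𝕜) (E := E) (F := F) t
  have := h n x y
  rw [← coe_projectiveAlg_sum, ← ht] at this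
  exact this

theorem projective_ext {G : Type*} [NormedAddCommGroup G] [NormedSpace 𝕜 G]
    {f g : ProjectiveTensor 𝕜 E F →L[𝕜] G}
    (h : ∀ x y, f (projTmul 𝕜 x y) = g (projTmul 𝕜 x y)) : f = g := by
  ext u
  refine projective_induction (isClosed_eq f.continuous g.continuous) (fun n x y => ?_) u
  rw [map_sum, map_sum]
  exact Finset.sum_congr rfl fun k _ => h _ _

theorem norm_projLift_le {G : Type*} [NormedAddCommGroup G] [NormedSpace 𝕜 G] [CompleteSpace G]
    (B : E →L[𝕜] F →L[𝕜] G) (u : ProjectiveTensor 𝕜 E F) : ‖projLift B u‖ ≤ ‖B‖ * ‖u‖ := by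
  refine UniformSpace.Completion.induction_on u
    (isClosed_le (projLift B).continuous.norm
      (continuous_const.mul (continuous_norm (E := ProjectiveTensor 𝕜 E F)))) fun t => ?_
  have h : projLift B (t : ProjectiveTensor 𝕜 E F) = projLiftAlg B t :=
    ContinuousLinearMap.extend_eq (projLiftAlg B)
      (e := (UniformSpace.Completion.toComplL : ProjectiveAlg 𝕜 E F →L[𝕜] _))
      UniformSpace.Completion.denseRange_coe (UniformSpace.Completion.isUniformInducing_coe _) t
  rw [h, UniformSpace.Completion.norm_coe]
  exact (projLiftAlg B).le_of_opNorm_le (LinearMap.mkContinuous_norm_le _ (norm_nonneg B) _) t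

variable [NormedSpace ℝ E] [NormedSpace ℝ F] [NormedSpace ℝ (ProjectiveTensor 𝕜 E F)]
  [IsScalarTower ℝ 𝕜 E] [IsScalarTower ℝ 𝕜 F] [IsScalarTower ℝ 𝕜 (ProjectiveTensor 𝕜 E F)]

variable (𝕜 E F) in
/-- The canonical real bilinear map to the projective tensor product. -/
noncomputable def projMkReal : E →ₗ[ℝ] F →ₗ[ℝ] ProjectiveTensor 𝕜 E F :=
  LinearMap.mk₂ ℝ (projTmul 𝕜) projTmul_add_left
    (fun c x y => by
      rw [← algebraMap_smul 𝕜 c x, projTmul_smul_left, algebraMap_smul])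
    projTmul_add_right
    (fun c x y => by
      rw [← algebraMap_smul 𝕜 c y, projTmul_smul_right, algebraMap_smul])

theorem projTmul_mem_closedAtomicCone {S : Set E} {T : Set F} {x : E} {y : F} {m m' : ℝ}
    (hx : (x, m) ∈ closedAtomicCone S) (hy : (y, m') ∈ closedAtomicCone T) :
    (projTmul 𝕜 x y, m * m') ∈ closedAtomicCone (Set.image2 (projTmul 𝕜) S T) := by
  have hc : Continuous fun p : E × F => projMkReal 𝕜 E F p.1 p.2 := continuous_projTmul
  have hU : ∀ s ∈ S, ∀ t ∈ T, projMkReal 𝕜 E F s t ∈ Set.image2 (projTmul 𝕜) S T :=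
    fun s hs t ht => Set.mem_image2_of_mem hs ht
  exact bilinear_mem_closedAtomicCone (projMkReal 𝕜 E F) hc hU hx hy

/-- Each finite decomposition of an algebraic tensor puts its value of `∑ ‖x_k‖ ‖y_k‖` into the
closed cone, as a weight. Closedness allows passing first to the infimum, which is the norm, and
then to the completion. -/
theorem norm_mem_closedAtomicCone_projective {S : Set E} {T : Set F}
    (hS : ∀ x, (x, ‖x‖) ∈ closedAtomicCone S) (hT : ∀ y, (y, ‖y‖) ∈ closedAtomicCone T)
    (u : ProjectiveTensor 𝕜 E F) :
    (u, ‖u‖) ∈ closedAtomicCone (Set.image2 (projTmul 𝕜) S T) := by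
  refine UniformSpace.Completion.induction_on u
    ((isClosed_closedAtomicCone _).preimage (by fun_prop)) fun t => ?_
  have h : ∀ a ∈ projectiveSums (𝕜 := 𝕜) t,
      ((t : ProjectiveTensor 𝕜 E F), a) ∈ closedAtomicCone (Set.image2 (projTmul 𝕜) S T) := by
    rintro _ ⟨n, x, y, ht, rfl⟩
    have h1 := (closedAtomicCone (Set.image2 (projTmul 𝕜) S T)).sum_mem
      (t := Finset.univ) (f := fun k => (projTmul 𝕜 (x k) (y k), ‖x k‖ * ‖y k‖)) fun k _ =>
      projTmul_mem_closedAtomicCone (hS (x k)) (hT (y k))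
    have h2 : ∑ k, (projTmul 𝕜 (x k) (y k), ‖x k‖ * ‖y k‖) =
        (UniformSpace.Completion.coe' (α := ProjectiveAlg 𝕜 E F) t, ∑ k, ‖x k‖ * ‖y k‖) :=
      Prod.ext (Prod.fst_sum.trans ((coe_projectiveAlg_sum x y).symm.trans
        (congrArg (UniformSpace.Completion.coe' (α := ProjectiveAlg 𝕜 E F)) ht.symm)))
        Prod.snd_sum
    rw [h2] at h1
    exact h1
  -- The infimum need not be attained, but it lies in the closure of the set of values.
  have h2 := csInf_mem_closure (projectiveSums_nonempty (𝕜 := 𝕜) (E := E) (F := F) t)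
    (projectiveSums_bddBelow (𝕜 := 𝕜) (E := E) (F := F) t)
  rw [← norm_coe_projectiveAlg] at h2
  exact closure_minimal h ((isClosed_closedAtomicCone _).preimage
    (Continuous.prodMk_right (t : ProjectiveTensor 𝕜 E F))) h2

end Projective

/-! ### Rank-one partial isometries as atoms of the trace class -/

namespace TraceClass

variable {H : Type*} [NormedAddCommGroup H] [InnerProductSpace ℂ H] [CompleteSpace H]
variable {ι : Type*}

open Filter Topology

theorem rankOne_smul_smul (a b : ℂ) (η φ : H) :
    rankOne (a • η) (b • φ) = (a * star b) • rankOne η φ := by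
  ext1
  simp [smul_smul]

theorem isRankOnePartialIsometry_rankOne {η φ : H} (hη : ‖η‖ = 1) (hφ : ‖φ‖ = 1) :
    IsRankOnePartialIsometry (rankOne η φ) := ⟨η, φ, hη, hφ, rfl⟩

theorem norm_of_isRankOnePartialIsometry {X : TraceClass H} (h : IsRankOnePartialIsometry X) :
    ‖X‖ = 1 := by
  obtain ⟨η, φ, hη, hφ, h⟩ := h
  have : X = rankOne η φ := TraceClass.ext h
  rw [this, norm_rankOne, hη, hφ, one_mul]

theorem conj_rankOne (S T : H →L[ℂ] H) (η φ : H) :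
    conj S T (rankOne η φ) = rankOne (S η) (star T φ) := by
  ext x
  simp [ContinuousLinearMap.star_eq_adjoint, ContinuousLinearMap.adjoint_inner_left]

theorem real_smul_eq (r : ℝ) (A : TraceClass H) : r • A = (r : ℂ) • A := rfl

theorem rankOne_mem_atomicCone (η φ : H) :
    (rankOne η φ, ‖η‖ * ‖φ‖) ∈ atomicCone {X : TraceClass H | IsRankOnePartialIsometry X} := by
  -- Vectors are normalised below, so zero vectors are treated apart; there the operator and the
  -- weight both vanish.
  by_cases h : η = 0 ∨ φ = 0
  · have h1 : ‖η‖ * ‖φ‖ = 0 := by simpa using h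
    have h2 : rankOne η φ = 0 := norm_eq_zero.mp ((norm_rankOne η φ).trans h1)
    rw [h1, h2]
    exact (atomicCone _).zero_mem
  · push Not at h
    have hη : ‖η‖ ≠ 0 := norm_ne_zero_iff.mpr h.1
    have hφ : ‖φ‖ ≠ 0 := norm_ne_zero_iff.mpr h.2
    have h1 := smul_mem_atomicCone (S := {X : TraceClass H | IsRankOnePartialIsometry X})
      (isRankOnePartialIsometry_rankOne (η := ((‖η‖⁻¹ : ℝ) : ℂ) • η) (φ := ((‖φ‖⁻¹ : ℝ) : ℂ) • φ)
        (by simp [norm_smul, hη]) (by simp [norm_smul, hφ]))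
      (mul_nonneg (norm_nonneg η) (norm_nonneg φ))
    have h2 : (‖η‖ * ‖φ‖) • rankOne (((‖η‖⁻¹ : ℝ) : ℂ) • η) (((‖φ‖⁻¹ : ℝ) : ℂ) • φ) =
        rankOne η φ := by
      have h3 : ((‖η‖ * ‖φ‖ : ℝ) : ℂ) * (((‖η‖⁻¹ : ℝ) : ℂ) * star ((‖φ‖⁻¹ : ℝ) : ℂ)) = 1 := by
        rw [RCLike.star_def, Complex.conj_ofReal, ← Complex.ofReal_mul, ← Complex.ofReal_mul,
          ← Complex.ofReal_one]
        congr 1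
        field_simp
      rw [rankOne_smul_smul, real_smul_eq, smul_smul, h3, one_smul]
    rwa [h2] at h1

/-- The weight is at most `∑ ‖R b_i‖ ^ 2` because `U` and `P` are contractions, and the full sum
over the basis is `tr |A|`. -/
theorem sum_rankOne_mem_atomicCone (b : HilbertBasis ι ℂ H) (A : TraceClass H)
    {R U P : H →L[ℂ] H} (hR : IsSelfAdjoint R) (hRA : R * R = CFC.abs A.toCLM) (hU : ‖U‖ ≤ 1)
    (hP : ‖P‖ ≤ 1) (G : Finset ι) :
    (∑ i ∈ G, rankOne (U (R (b i))) (P (R (b i))), ‖A‖) ∈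
      atomicCone {X : TraceClass H | IsRankOnePartialIsometry X} := by
  have h1 := (atomicCone {X : TraceClass H | IsRankOnePartialIsometry X}).sum_mem
    (t := G) fun i _ => rankOne_mem_atomicCone (U (R (b i))) (P (R (b i)))
  have h0 : ∑ i ∈ G, (rankOne (U (R (b i))) (P (R (b i))), ‖U (R (b i))‖ * ‖P (R (b i))‖) =
      (∑ i ∈ G, rankOne (U (R (b i))) (P (R (b i))), ∑ i ∈ G, ‖U (R (b i))‖ * ‖P (R (b i))‖) :=
    Prod.ext Prod.fst_sum Prod.snd_sum
  rw [h0] at h1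
  refine atomicCone_mono_right h1 ?_
  have h2 : ∑ i ∈ G, ‖U (R (b i))‖ * ‖P (R (b i))‖ ≤ ∑ i ∈ G, ‖R (b i)‖ ^ 2 := by
    refine Finset.sum_le_sum fun i _ => ?_
    rw [pow_two]
    exact mul_le_mul ((U.le_of_opNorm_le hU _).trans_eq (one_mul _))
      ((P.le_of_opNorm_le hP _).trans_eq (one_mul _)) (norm_nonneg _) (norm_nonneg _)
  refine h2.trans ?_
  rw [← ENNReal.ofReal_le_ofReal_iff (norm_nonneg A), ofReal_norm_eq,
    traceENorm_eq_hs b A.toCLM R hR hRA, ENNReal.ofReal_sum_of_nonneg fun i _ => by positivity]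
  simp_rw [ENNReal.ofReal_pow (norm_nonneg _), ofReal_norm]
  exact ENNReal.sum_le_tsum G

/-- The absolute value of a trace class operator. -/
noncomputable def absOp (A : TraceClass H) : TraceClass H :=
  mk (CFC.abs A.toCLM) (by
    have h : traceENorm (CFC.abs A.toCLM) = traceENorm A.toCLM := by
      rw [traceENorm, traceENorm, CFC.cfcAbs_cfcAbs]
    rw [h]
    exact A.traceENorm_lt_top)

/-- The remainder is `R (1 - P_G) R`, since `R` is self-adjoint; its trace norm is bounded by a
product of Hilbert–Schmidt norms, one of which tends to zero. -/
theorem tendsto_sum_rankOne_absOp (b : HilbertBasis ι ℂ H) (A : TraceClass H) {R : H →L[ℂ] H}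
    (hR : IsSelfAdjoint R) (hRA : R * R = CFC.abs A.toCLM) :
    Tendsto (fun G => ∑ i ∈ G, rankOne (R (b i)) (R (b i))) atTop (𝓝 (absOp A)) := by
  have hsum : ∀ (s : Finset ι) (f : ι → TraceClass H),
      (∑ p ∈ s, f p).toCLM = ∑ p ∈ s, (f p).toCLM := fun s f =>
    map_sum (⟨⟨toCLM, rfl⟩, fun _ _ => rfl⟩ : TraceClass H →+ (H →L[ℂ] H)) f s
  have htr := traceENorm_eq_hs b A.toCLM R hR hRA
  have h1 : ∑' i, ‖R (b i)‖ₑ ^ 2 ≠ ⊤ := htr.symm.trans_ne A.traceENorm_lt_top.ne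
  refine tendsto_of_traceENorm ?_
  refine tendsto_of_tendsto_of_tendsto_of_le_of_le tendsto_const_nhds
    (tendsto_rpow_half_zero _ h1 (tendsto_hs_sub_basisProj b R h1))
    (fun _ => zero_le) fun G => ?_
  have h2 : (absOp A - ∑ i ∈ G, rankOne (R (b i)) (R (b i))).toCLM =
      (R * (1 - basisProj b G)) * R := by
    rw [toCLM_sub, hsum, mul_sub, sub_mul, mul_one, hRA]
    refine congrArg₂ _ rfl ?_
    rw [basisProj, Finset.mul_sum, Finset.sum_mul]
    refine Finset.sum_congr rfl fun i _ => ?_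
    ext x
    have : ⟪R (b i), x⟫_ℂ = ⟪b i, R x⟫_ℂ := by
      rw [← ContinuousLinearMap.adjoint_inner_left, ContinuousLinearMap.isSelfAdjoint_iff'.mp hR]
    simp [this]
  change traceENorm (absOp A - ∑ i ∈ G, rankOne (R (b i)) (R (b i))).toCLM ≤ _
  rw [h2, mul_comm (_ ^ _)]
  exact traceENorm_mul_le_hs b _ _

theorem traceENorm_basisProj_lt_top (b : HilbertBasis ι ℂ H) (F : Finset ι) :
    traceENorm (basisProj b F) < ⊤ :=
  (traceClass H).sum_mem fun i _ => (rankOne (b i) (b i)).traceENorm_lt_top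

/-- The trace norm is attained approximately by combinations of rank-one partial isometries. -/
theorem norm_mem_closedAtomicCone (A : TraceClass H) :
    (A, ‖A‖) ∈ closedAtomicCone {X : TraceClass H | IsRankOnePartialIsometry X} := by
  set K := closedAtomicCone {X : TraceClass H | IsRankOnePartialIsometry X} with hK
  have hcl : IsClosed {X : TraceClass H | (X, ‖A‖) ∈ K} :=
    (isClosed_closedAtomicCone _).preimage (by fun_prop)
  obtain ⟨w, b, -⟩ := exists_hilbertBasis ℂ H
  obtain ⟨R, hR, hRA⟩ := abs_eq_sq A.toCLM
  -- For a contraction `U`, the operator `U |A| P_F` is a limit of sums of `|U R b_i⟩⟨P_F R b_i|`,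
  -- all of weight at most `‖A‖`.
  have step1 : ∀ (U : H →L[ℂ] H) (F : Finset w), ‖U‖ ≤ 1 →
      (conj U (basisProj b F) (absOp A), ‖A‖) ∈ K := by
    intro U F hU
    have h1 := ((conj U (basisProj b F)).continuous.tendsto _).comp
      (tendsto_sum_rankOne_absOp b A hR hRA)
    refine hcl.mem_of_tendsto h1 (Eventually.of_forall fun G => ?_)
    have h2 := sum_rankOne_mem_atomicCone b A hR hRA hU (norm_basisProj_le b F) G
    have h3 : conj U (basisProj b F) (∑ i ∈ G, rankOne (R (b i)) (R (b i))) =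
        ∑ i ∈ G, rankOne (U (R (b i))) (basisProj b F (R (b i))) := by
      simp_rw [map_sum, conj_rankOne, star_basisProj]
    change (conj U (basisProj b F) (∑ i ∈ G, rankOne (R (b i)) (R (b i))), ‖A‖) ∈ K
    rw [h3]
    exact atomicCone_le_closed _ h2
  -- The approximate polar decomposition controls `A - U |A|` only in operator norm. Multiplication
  -- by the finite-rank `P_F` turns this into a trace norm estimate, which is why `P_F` is removed
  -- last.
  have step2 : ∀ F : Finset w, (conj 1 (basisProj b F) A, ‖A‖) ∈ K := by
    intro F
    choose U hU hUA _ using fun n : ℕ => exists_polar A.toCLM (ε := 1 / ((n : ℝ) + 1))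
      Nat.one_div_pos_of_nat
    suffices ht : Tendsto (fun n => conj (U n) (basisProj b F) (absOp A)) atTop
        (𝓝 (conj 1 (basisProj b F) A)) from
      hcl.mem_of_tendsto ht (Eventually.of_forall fun n => step1 _ F (hU n))
    refine tendsto_of_traceENorm ?_
    have h1 : Tendsto (fun n : ℕ => ENNReal.ofReal (1 / ((n : ℝ) + 1)) *
        traceENorm (basisProj b F)) atTop (𝓝 0) := by
      have h2 := ENNReal.tendsto_ofReal (tendsto_one_div_add_atTop_nhds_zero_nat (𝕜 := ℝ))
      rw [ENNReal.ofReal_zero] at h2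
      simpa using ENNReal.Tendsto.mul_const h2 (Or.inr (traceENorm_basisProj_lt_top b F).ne)
    refine tendsto_of_tendsto_of_tendsto_of_le_of_le tendsto_const_nhds h1 (fun _ => zero_le)
      fun n => ?_
    have h2 : (conj 1 (basisProj b F) A - conj (U n) (basisProj b F) (absOp A)).toCLM =
        (A.toCLM - U n * CFC.abs A.toCLM) * basisProj b F := by
      rw [toCLM_sub, toCLM_conj, toCLM_conj, one_mul, sub_mul]
      rfl
    change traceENorm (conj 1 (basisProj b F) A - conj (U n) (basisProj b F) (absOp A)).toCLM ≤ _
    rw [h2]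
    refine (traceENorm_mul_le _ _).trans ?_
    rw [← ofReal_norm]
    gcongr
    exact hUA n
  exact hcl.mem_of_tendsto (tendsto_mul_basisProj b A) (Eventually.of_forall step2)

end TraceClass

/-! ### Injectivity from finite-rank approximate identities -/

section Injectivity

open Filter Topology

variable {𝕜 E F G : Type*} [RCLike 𝕜] [NormedAddCommGroup E] [NormedSpace 𝕜 E]
  [NormedAddCommGroup F] [NormedSpace 𝕜 F] [NormedAddCommGroup G] [NormedSpace 𝕜 G]

/-- The tensor product of two bounded linear operators on the projective tensor product. -/
noncomputable def projMap (S : E →L[𝕜] E) (T : F →L[𝕜] F) :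
    ProjectiveTensor 𝕜 E F →L[𝕜] ProjectiveTensor 𝕜 E F :=
  projLift ((projMk 𝕜 E F).bilinearComp S T)

theorem projMap_tmul (S : E →L[𝕜] E) (T : F →L[𝕜] F) (x : E) (y : F) :
    projMap S T (projTmul 𝕜 x y) = projTmul 𝕜 (S x) (T y) :=
  projLift_tmul _ x y

theorem norm_projMap_le {S : E →L[𝕜] E} {T : F →L[𝕜] F} (hS : ∀ x, ‖S x‖ ≤ ‖x‖)
    (hT : ∀ y, ‖T y‖ ≤ ‖y‖) (u : ProjectiveTensor 𝕜 E F) : ‖projMap S T u‖ ≤ ‖u‖ := by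
  have h : ‖(projMk 𝕜 E F).bilinearComp S T‖ ≤ 1 := by
    refine ContinuousLinearMap.opNorm_le_bound₂ _ zero_le_one fun x y => ?_
    rw [one_mul]
    exact (norm_projTmul_le (S x) (T y)).trans
      (mul_le_mul (hS x) (hT y) (norm_nonneg _) (norm_nonneg _))
  exact (norm_projLift_le _ u).trans (mul_le_of_le_one_left (norm_nonneg _) h)

/-- An `ε / 3` argument: for a family of contractions, strong convergence to the identity extends
from a set to its closed linear span. -/
theorem tendsto_of_mem_closure_span {α V : Type*} [NormedAddCommGroup V] [NormedSpace 𝕜 V]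
    {l : Filter α} {L : α → V →L[𝕜] V} (hL : ∀ a v, ‖L a v‖ ≤ ‖v‖) {D : Set V}
    (hD : ∀ v ∈ D, Tendsto (fun a => L a v) l (𝓝 v)) {u : V}
    (hu : u ∈ closure (Submodule.span 𝕜 D : Set V)) : Tendsto (fun a => L a u) l (𝓝 u) := by
  rw [Metric.tendsto_nhds]
  intro ε hε
  obtain ⟨v, hv, huv⟩ := Metric.mem_closure_iff.mp hu (ε / 3) (by positivity)
  have hvt : Tendsto (fun a => L a v) l (𝓝 v) := by
    clear huv
    induction hv using Submodule.span_induction with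
    | mem v hv => exact hD v hv
    | zero => simpa using tendsto_const_nhds
    | add v w _ _ h1 h2 => simpa using h1.add h2
    | smul c v _ h1 => simpa using h1.const_smul c
  filter_upwards [Metric.tendsto_nhds.mp hvt (ε / 3) (by positivity)] with a ha
  have h1 : dist (L a u) (L a v) ≤ dist u v := by
    rw [dist_eq_norm, dist_eq_norm, ← map_sub]
    exact hL _ _
  have h2 := dist_triangle4 (L a u) (L a v) v u
  rw [dist_comm v u] at h2
  linarith

theorem mem_closure_span_projTmul (u : ProjectiveTensor 𝕜 E F) :
    u ∈ closure (Submodule.span 𝕜 (Set.range fun p : E × F => projTmul 𝕜 p.1 p.2) :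
      Set (ProjectiveTensor 𝕜 E F)) :=
  projective_induction isClosed_closure (fun _ x y => subset_closure (Submodule.sum_mem _
    fun k _ => Submodule.subset_span (Set.mem_range_self (x k, y k)))) u

theorem tendsto_projMap {α β : Type*} {l : Filter α} {l' : Filter β} {S : α → E →L[𝕜] E}
    {T : β → F →L[𝕜] F} (hS : ∀ a x, ‖S a x‖ ≤ ‖x‖) (hT : ∀ a y, ‖T a y‖ ≤ ‖y‖)
    (hSl : ∀ x, Tendsto (fun a => S a x) l (𝓝 x)) (hTl : ∀ y, Tendsto (fun a => T a y) l' (𝓝 y))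
    (u : ProjectiveTensor 𝕜 E F) :
    Tendsto (fun a : α × β => projMap (S a.1) (T a.2) u) (l ×ˢ l') (𝓝 u) := by
  have h0 : ∀ (a : α × β) (v : ProjectiveTensor 𝕜 E F), ‖projMap (S a.1) (T a.2) v‖ ≤ ‖v‖ :=
    fun a v => norm_projMap_le (hS a.1) (hT a.2) v
  refine tendsto_of_mem_closure_span (L := fun a : α × β => projMap (S a.1) (T a.2)) h0 ?_
    (mem_closure_span_projTmul u)
  rintro _ ⟨⟨x, y⟩, rfl⟩
  have h1 : Tendsto (fun a : α × β => (S a.1 x, T a.2 y)) (l ×ˢ l') (𝓝 (x, y)) :=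
    ((hSl x).comp tendsto_fst).prodMk_nhds ((hTl y).comp tendsto_snd)
  have h2 : Tendsto (fun p : E × F => projTmul 𝕜 p.1 p.2) (𝓝 (x, y)) (𝓝 (projTmul 𝕜 x y)) :=
    continuous_projTmul.tendsto (x, y)
  exact (h2.comp h1).congr fun a => (projMap_tmul _ _ _ _).symm

/-- Injectivity of the map induced on the projective tensor product by a bilinear map, when the
factors have approximate identities of finite rank, whose coefficients extend to the target. -/
theorem projLift_injective [CompleteSpace G] (B : E →L[𝕜] F →L[𝕜] G) {α β γ δ : Type*}
    {l : Filter α} {l' : Filter β} [l.NeBot] [l'.NeBot] {S : α → E →L[𝕜] E} {T : β → F →L[𝕜] F}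
    (hS : ∀ a x, ‖S a x‖ ≤ ‖x‖) (hT : ∀ a y, ‖T a y‖ ≤ ‖y‖)
    (hSl : ∀ x, Tendsto (fun a => S a x) l (𝓝 x)) (hTl : ∀ y, Tendsto (fun a => T a y) l' (𝓝 y))
    (f : γ → E → 𝕜) (e : γ → E) (g : δ → F → 𝕜) (d : δ → F)
    (hSf : ∀ a, ∃ s : Finset γ, ∀ x, S a x = ∑ c ∈ s, f c x • e c)
    (hTg : ∀ a, ∃ s : Finset δ, ∀ y, T a y = ∑ c ∈ s, g c y • d c)
    (φ : γ → δ → G →L[𝕜] 𝕜) (hφ : ∀ c c' x y, φ c c' (B x y) = f c x * g c' y) :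
    Function.Injective (projLift B) := by
  rw [injective_iff_map_eq_zero]
  intro u hu
  -- The approximants `projMap (S a) (T b) u` tend to `u`; it remains to see that each of them
  -- vanishes.
  refine tendsto_nhds_unique (tendsto_projMap hS hT hSl hTl u) ?_
  refine tendsto_const_nhds.congr fun a => ?_
  obtain ⟨s, hs⟩ := hSf a.1
  obtain ⟨t, ht⟩ := hTg a.2
  -- By finite rank, `S ⊗ T` is a finite sum with coefficients `f c x * g c' y = φ c c' (B x y)`. It
  -- factors through `projLift B` and so kills `u`.
  have h : projMap (S a.1) (T a.2) = ∑ p ∈ s ×ˢ t,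
      ((φ p.1 p.2).comp (projLift B)).smulRight (projTmul 𝕜 (e p.1) (d p.2)) := by
    refine projective_ext fun x y => ?_
    rw [projMap_tmul, hs, ht, ← projMk_apply, map_sum (projMk 𝕜 E F), sum_apply, sum_apply,
      Finset.sum_product]
    refine Finset.sum_congr rfl fun c _ => ?_
    rw [map_sum]
    refine Finset.sum_congr rfl fun c' _ => ?_
    simp [projLift_tmul, hφ, smul_smul, mul_comm]
  rw [h, sum_apply]
  simp [hu]

end Injectivity

/-! ### Matrix coefficients of tensor products -/

namespace TraceClass

variable {H : Type*} [NormedAddCommGroup H] [InnerProductSpace ℂ H] [CompleteSpace H]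
variable {J : Type*} [NormedAddCommGroup J] [InnerProductSpace ℂ J] [CompleteSpace J]

/-- The inclusion of the trace class in the bounded operators. -/
noncomputable def toCLML (H : Type*) [NormedAddCommGroup H] [InnerProductSpace ℂ H]
    [CompleteSpace H] : TraceClass H →L[ℂ] (H →L[ℂ] H) :=
  LinearMap.mkContinuous ⟨⟨toCLM, toCLM_add⟩, toCLM_smul⟩ 1 fun A => by
    rw [one_mul]; exact opNorm_le A

@[simp] theorem toCLML_apply (A : TraceClass H) : toCLML H A = A.toCLM := rfl

theorem toCLM_real_smul (r : ℝ) (A : TraceClass H) : (r • A).toCLM = r • A.toCLM := by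
  rw [real_smul_eq, toCLM_smul, Complex.coe_smul]

/-- The matrix coefficient `A ↦ ⟪x, A y⟫`. -/
noncomputable def matrixCoeff (x y : H) : TraceClass H →L[ℂ] ℂ :=
  (innerSL ℂ x).comp ((ContinuousLinearMap.apply ℂ H y).comp (toCLML H))

@[simp] theorem matrixCoeff_apply (x y : H) (A : TraceClass H) :
    matrixCoeff x y A = ⟪x, A.toCLM y⟫_ℂ := rfl

theorem matrixCoeff_tensor (x y : H) (x' y' : J) (A : TraceClass H) (B : TraceClass J) :
    matrixCoeff (hilbertTmul x x') (hilbertTmul y y') (tensor A B) =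
      matrixCoeff x y A * matrixCoeff x' y' B := by
  rw [matrixCoeff_apply, tensor, toCLM_mk, opTensor_tmul, inner_hilbertTmul]
  rfl

theorem matrixCoeff_star (x y : H) (A : TraceClass H) :
    matrixCoeff x y (star A) = star (matrixCoeff y x A) := by
  simp [ContinuousLinearMap.star_eq_adjoint, ContinuousLinearMap.adjoint_inner_right]

theorem tensor_mul (A A' : TraceClass H) (B B' : TraceClass J) :
    tensor (A * A') (B * B') = tensor A B * tensor A' B' :=
  TraceClass.ext (opTensor_mul _ _ _ _)

end TraceClass

/-! ### Injectivity of the complex immersion -/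

section Immersion

variable {H : Type*} [NormedAddCommGroup H] [InnerProductSpace ℂ H] [CompleteSpace H]
variable {J : Type*} [NormedAddCommGroup J] [InnerProductSpace ℂ J] [CompleteSpace J]

open TraceClass

theorem immersionSA_tmul (A : TraceClassSA H) (B : TraceClassSA J) :
    immersionSA H J (projTmul ℝ A B) = TraceClassSA.tensor A B := projLift_tmul _ _ _

theorem norm_basisProj_conj_le {ι : Type*} (b : HilbertBasis ι ℂ H) (F : Finset ι)
    (A : TraceClass H) : ‖conj (basisProj b F) (basisProj b F) A‖ ≤ ‖A‖ :=
  norm_conj_le_of_le_one (norm_basisProj_le b F) (norm_basisProj_le b F) A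

/-- Compressions to finite parts of two bases are the approximate identities. Their coefficients
extend to the target as matrix coefficients at product vectors. -/
theorem immersion_injective : Function.Injective (immersion H J) := by
  obtain ⟨w, b, -⟩ := exists_hilbertBasis ℂ H
  obtain ⟨w', c, -⟩ := exists_hilbertBasis ℂ J
  exact projLift_injective TraceClass.tensorBilin (norm_basisProj_conj_le b)
    (norm_basisProj_conj_le c) (tendsto_basisProj_conj b) (tendsto_basisProj_conj c)
    (fun (p : w × w) A => matrixCoeff (b p.1) (b p.2) A) (fun p => rankOne (b p.1) (b p.2))
    (fun (p : w' × w') A => matrixCoeff (c p.1) (c p.2) A) (fun p => rankOne (c p.1) (c p.2))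
    (fun F => ⟨F ×ˢ F, conj_basisProj_eq_sum b F⟩) (fun F => ⟨F ×ˢ F, conj_basisProj_eq_sum c F⟩)
    (fun p q => matrixCoeff (hilbertTmul (b p.1) (c q.1)) (hilbertTmul (b p.2) (c q.2)))
    (fun p q A B => matrixCoeff_tensor _ _ _ _ A B)

end Immersion

/-! ### Real parts, compressions and real functionals -/

namespace TraceClassSA

variable {H : Type*} [NormedAddCommGroup H] [InnerProductSpace ℂ H] [CompleteSpace H]
variable {J : Type*} [NormedAddCommGroup J] [InnerProductSpace ℂ J] [CompleteSpace J]

open TraceClass Filter Topology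

theorem star_coe (A : TraceClassSA H) : star A.1 = A.1 := A.2

/-- The self-adjoint part `(A + A⋆) / 2`. -/
noncomputable def ofRealPart (H : Type*) [NormedAddCommGroup H] [InnerProductSpace ℂ H]
    [CompleteSpace H] : TraceClass H →L[ℝ] TraceClassSA H :=
  LinearMap.mkContinuous
    { toFun := fun A => ⟨(2⁻¹ : ℝ) • (A + star A), by
        change star ((2⁻¹ : ℝ) • (A + star A)) = (2⁻¹ : ℝ) • (A + star A)
        simp [real_smul_eq, add_comm, -Complex.coe_smul]⟩
      map_add' := fun A B => Subtype.ext (by simp only [star_add, smul_add, Submodule.coe_add]; abel)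
      map_smul' := fun c A => Subtype.ext (by
        simp only [RingHom.id_apply, Submodule.coe_smul, smul_comm _ (2⁻¹ : ℝ)]
        simp [real_smul_eq, -Complex.coe_smul]) }
    1 fun A => by
      change ‖(2⁻¹ : ℝ) • (A + star A)‖ ≤ 1 * ‖A‖
      rw [norm_smul, Real.norm_of_nonneg (by norm_num)]
      have := norm_add_le A (star A)
      rw [norm_star] at this
      linarith

theorem coe_ofRealPart (A : TraceClass H) :
    (ofRealPart H A : TraceClass H) = (2⁻¹ : ℝ) • (A + star A) := rfl

theorem norm_ofRealPart_le (A : TraceClass H) : ‖ofRealPart H A‖ ≤ ‖A‖ := by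
  have h := (ofRealPart H).le_of_opNorm_le (LinearMap.mkContinuous_norm_le _ zero_le_one _) A
  rwa [one_mul] at h

theorem ofRealPart_coe (A : TraceClassSA H) : ofRealPart H A.1 = A := by
  ext1
  rw [coe_ofRealPart, star_coe, ← two_smul ℝ, smul_smul]
  norm_num

theorem ofRealPart_I_smul_coe (A : TraceClassSA H) : ofRealPart H (Complex.I • A.1) = 0 := by
  ext1
  simp [coe_ofRealPart, star_smul, star_coe]

theorem ofRealPart_smul (z : ℂ) (A : TraceClass H) :
    ofRealPart H (z • A) = z.re • ofRealPart H A + z.im • ofRealPart H (Complex.I • A) := by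
  rw [← map_smul, ← map_smul, ← map_add]
  congr 1
  rw [real_smul_eq, real_smul_eq, smul_smul, ← add_smul, Complex.re_add_im]

/-- The Cartesian decomposition, with the imaginary part written as the real part of `-i A`. -/
theorem eq_ofRealPart_add (A : TraceClass H) :
    A = (ofRealPart H A).1 + Complex.I • (ofRealPart H (-Complex.I • A)).1 := by
  rw [coe_ofRealPart, coe_ofRealPart, real_smul_eq, real_smul_eq]
  simp only [star_smul, smul_add, smul_smul, star_neg, RCLike.star_def, Complex.conj_I]
  have h1 : Complex.I * (((2⁻¹ : ℝ) : ℂ) * -Complex.I) = ((2⁻¹ : ℝ) : ℂ) := by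
    ring_nf; simp
  have h2 : Complex.I * (((2⁻¹ : ℝ) : ℂ) * - -Complex.I) = -((2⁻¹ : ℝ) : ℂ) := by
    ring_nf; simp
  rw [h1, h2]
  have h3 : A = ((2⁻¹ : ℝ) : ℂ) • A + ((2⁻¹ : ℝ) : ℂ) • A := by
    rw [← add_smul, ← Complex.ofReal_add]
    norm_num
  rw [neg_smul]
  nth_rw 1 [h3]
  abel

theorem coe_tensor (A : TraceClassSA H) (B : TraceClassSA J) :
    (tensor A B).1 = TraceClass.tensor A.1 B.1 := rfl

/-- The self-adjoint part of a tensor product. -/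
theorem ofRealPart_tensor (A : TraceClass H) (B : TraceClass J) :
    ofRealPart _ (TraceClass.tensor A B) =
      tensor (ofRealPart H A) (ofRealPart J B) -
        tensor (ofRealPart H (-Complex.I • A)) (ofRealPart J (-Complex.I • B)) := by
  set A₁ := ofRealPart H A
  set B₁ := ofRealPart J B
  set A₂ := ofRealPart H (-Complex.I • A)
  set B₂ := ofRealPart J (-Complex.I • B)
  have hA : A = A₁.1 + Complex.I • A₂.1 := eq_ofRealPart_add A
  have hB : B = B₁.1 + Complex.I • B₂.1 := eq_ofRealPart_add B
  -- Expand both Cartesian decompositions: the cross terms form `i` times a self-adjoint operator,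
  -- whose real part is zero.
  have h : TraceClass.tensor A B = (tensor A₁ B₁ - tensor A₂ B₂).1 +
      Complex.I • (tensor A₁ B₂ + tensor A₂ B₁).1 := by
    rw [hA, hB, ← tensorBilin_apply]
    simp only [map_add, map_smul, add_apply, smul_apply, tensorBilin_apply, Submodule.coe_add,
      Submodule.coe_sub, coe_tensor, smul_add, smul_smul, Complex.I_mul_I, neg_smul, one_smul]
    abel
  rw [h, map_add, ofRealPart_coe, ofRealPart_I_smul_coe, add_zero]

/-- Compression of self-adjoint trace class operators by a self-adjoint operator. -/
noncomputable def compress (P : H →L[ℂ] H) : TraceClassSA H →L[ℝ] TraceClassSA H :=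
  (ofRealPart H).comp (((conj P P).restrictScalars ℝ).comp
    (selfAdjoint.submodule ℝ (TraceClass H)).subtypeL)

theorem compress_apply (P : H →L[ℂ] H) (A : TraceClassSA H) :
    compress P A = ofRealPart H (conj P P A.1) := rfl

theorem norm_compress_basisProj_le {ι : Type*} (b : HilbertBasis ι ℂ H) (F : Finset ι)
    (A : TraceClassSA H) : ‖compress (basisProj b F) A‖ ≤ ‖A‖ :=
  (norm_ofRealPart_le _).trans (norm_basisProj_conj_le b F A.1)

theorem tendsto_compress_basisProj {ι : Type*} (b : HilbertBasis ι ℂ H) (A : TraceClassSA H) :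
    Tendsto (fun F => compress (basisProj b F) A) atTop (𝓝 A) := by
  have h := ((ofRealPart H).continuous.tendsto A.1).comp (tendsto_basisProj_conj b A.1)
  rw [ofRealPart_coe] at h
  exact h

/-- The real functional `A ↦ Re (k ⟪x, A y⟫)`. -/
noncomputable def realCoeff (k : ℂ) (x y : H) : TraceClassSA H →L[ℝ] ℝ :=
  Complex.reCLM.comp (((k • matrixCoeff x y).restrictScalars ℝ).comp
    (selfAdjoint.submodule ℝ (TraceClass H)).subtypeL)

theorem realCoeff_apply (k : ℂ) (x y : H) (A : TraceClassSA H) :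
    realCoeff k x y A = (k * matrixCoeff x y A.1).re := rfl

/-- Use `Re (z E) = Re z • Re E + Im z • Re (i E)` for each matrix unit `E`. The extra index `k ∈
{1, i}` selects the summand, as `Re (k̄ z)` is `Re z` or `Im z`. -/
theorem compress_basisProj_eq_sum {ι : Type*} (b : HilbertBasis ι ℂ H) (F : Finset ι)
    (A : TraceClassSA H) :
    compress (basisProj b F) A = ∑ p ∈ (F ×ˢ F) ×ˢ ({1, Complex.I} : Finset ℂ),
      realCoeff (star p.2) (b p.1.1) (b p.1.2) A •
        ofRealPart H (p.2 • rankOne (b p.1.1) (b p.1.2)) := by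
  have h1 : (1 : ℂ) ≠ Complex.I := fun h => by simpa using congrArg Complex.re h
  have h2 : ∀ p : ι × ι,
      ofRealPart H (⟪b p.1, A.1.toCLM (b p.2)⟫_ℂ • rankOne (b p.1) (b p.2)) =
        ∑ k ∈ ({1, Complex.I} : Finset ℂ), realCoeff (star k) (b p.1) (b p.2) A •
          ofRealPart H (k • rankOne (b p.1) (b p.2)) := by
    intro p
    rw [Finset.sum_pair h1, ofRealPart_smul]
    simp [realCoeff_apply]
  rw [compress_apply, conj_basisProj_eq_sum, map_sum (ofRealPart H)]
  exact (Finset.sum_congr rfl fun p _ => h2 p).trans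
    (Finset.sum_product' (F ×ˢ F) {1, Complex.I} fun p k => realCoeff (star k) (b p.1) (b p.2) A •
      ofRealPart H (k • rankOne (b p.1) (b p.2))).symm

/-- This is `Re a * Re b = (Re (a b) + Re (a b̄)) / 2`. Since `B` is self-adjoint, conjugating its
coefficient amounts to swapping `x'` and `y'`, so both terms are coefficients of the tensor product.
-/
theorem realCoeff_tensor (k k' : ℂ) (x y : H) (x' y' : J) (A : TraceClassSA H)
    (B : TraceClassSA J) :
    ((2⁻¹ : ℝ) • (realCoeff (k * k') (hilbertTmul x x') (hilbertTmul y y') +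
      realCoeff (k * star k') (hilbertTmul x y') (hilbertTmul y x'))) (tensor A B) =
      realCoeff k x y A * realCoeff k' x' y' B := by
  have h : matrixCoeff y' x' B.1 = star (matrixCoeff x' y' B.1) := by
    rw [← matrixCoeff_star, star_coe]
  rw [smul_apply, add_apply]
  simp only [realCoeff_apply, coe_tensor, matrixCoeff_tensor]
  rw [h]
  generalize matrixCoeff x' y' B.1 = z
  generalize matrixCoeff x y A.1 = z'
  simp only [Complex.mul_re, Complex.mul_im, RCLike.star_def, Complex.conj_re, Complex.conj_im,
    smul_eq_mul]
  ring

end TraceClassSA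

/-! ### Injectivity of the real immersion -/

section ImmersionSA

variable {H : Type*} [NormedAddCommGroup H] [InnerProductSpace ℂ H] [CompleteSpace H]
variable {J : Type*} [NormedAddCommGroup J] [InnerProductSpace ℂ J] [CompleteSpace J]

open TraceClass TraceClassSA

theorem immersionSA_injective : Function.Injective (immersionSA H J) := by
  obtain ⟨w, b, -⟩ := exists_hilbertBasis ℂ H
  obtain ⟨w', c, -⟩ := exists_hilbertBasis ℂ J
  exact projLift_injective TraceClassSA.tensorBilin (norm_compress_basisProj_le b)
    (norm_compress_basisProj_le c) (tendsto_compress_basisProj b) (tendsto_compress_basisProj c)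
    (fun (p : (w × w) × ℂ) A => realCoeff (star p.2) (b p.1.1) (b p.1.2) A)
    (fun p => ofRealPart H (p.2 • rankOne (b p.1.1) (b p.1.2)))
    (fun (p : (w' × w') × ℂ) A => realCoeff (star p.2) (c p.1.1) (c p.1.2) A)
    (fun p => ofRealPart J (p.2 • rankOne (c p.1.1) (c p.1.2)))
    (fun F => ⟨_, compress_basisProj_eq_sum b F⟩) (fun F => ⟨_, compress_basisProj_eq_sum c F⟩)
    (fun p q => (2⁻¹ : ℝ) •
      (realCoeff (star p.2 * star q.2) (hilbertTmul (b p.1.1) (c q.1.1))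
        (hilbertTmul (b p.1.2) (c q.1.2)) +
      realCoeff (star p.2 * star (star q.2)) (hilbertTmul (b p.1.1) (c q.1.2))
        (hilbertTmul (b p.1.2) (c q.1.1))))
    (fun p q A B => realCoeff_tensor _ _ _ _ _ _ A B)

end ImmersionSA

/-! ### Separability -/

section Separable

open TopologicalSpace

theorem separableSpace_projectiveTensor {𝕜 E F : Type*} [RCLike 𝕜] [NormedAddCommGroup E]
    [NormedSpace 𝕜 E] [NormedAddCommGroup F] [NormedSpace 𝕜 F] [SeparableSpace E]
    [SeparableSpace F] : SeparableSpace (ProjectiveTensor 𝕜 E F) := by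
  have h1 : IsSeparable (Set.range fun p : E × F => projTmul 𝕜 p.1 p.2) :=
    isSeparable_range continuous_projTmul
  have h2 := (h1.span (R := 𝕜)).closure
  exact isSeparable_univ_iff.mp (h2.mono fun u _ => mem_closure_span_projTmul u)

variable {H : Type*} [NormedAddCommGroup H] [InnerProductSpace ℂ H] [CompleteSpace H]

theorem continuous_rankOne :
    Continuous fun p : H × H => TraceClass.rankOne p.1 p.2 := by
  -- `rankOne` is conjugate-linear in its second variable, so it is treated as a bounded bilinear
  -- map over `ℝ`.
  have := (LinearMap.mkContinuous₂ (LinearMap.mk₂ ℝ (TraceClass.rankOne (H := H))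
    (fun _ _ _ => by ext1; simp)
    (fun c x y => by ext z; simp [TraceClass.toCLM_real_smul])
    (fun _ _ _ => by ext1; simp)
    (fun c x y => by
      ext z
      have h : ⟪c • y, z⟫_ℂ = c • ⟪y, z⟫_ℂ := by
        rw [← Complex.coe_smul, inner_smul_left, Complex.conj_ofReal, Complex.real_smul]
      simp only [TraceClass.toCLM_real_smul, TraceClass.toCLM_rankOne, smul_apply,
        InnerProductSpace.rankOne_apply, h, smul_assoc])) 1
    fun x y => by rw [one_mul]; exact (TraceClass.norm_rankOne x y).le).continuous₂
  exact this

/-- Compressions show that the rank-one operators, a continuous image of `H × H`, span a dense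
subspace. -/
theorem separableSpace_traceClass [SeparableSpace H] : SeparableSpace (TraceClass H) := by
  have h1 : IsSeparable (Set.range fun p : H × H => TraceClass.rankOne p.1 p.2) :=
    isSeparable_range continuous_rankOne
  have h2 := (h1.span (R := ℂ)).closure
  refine isSeparable_univ_iff.mp (h2.mono fun A _ => ?_)
  obtain ⟨w, b, -⟩ := exists_hilbertBasis ℂ H
  refine mem_closure_of_tendsto (TraceClass.tendsto_basisProj_conj b A)
    (Filter.Eventually.of_forall fun F => ?_)
  rw [TraceClass.conj_basisProj_eq_sum]
  exact Submodule.sum_mem _ fun p _ => Submodule.smul_mem _ _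
    (Submodule.subset_span (Set.mem_range_self (b p.1, b p.2)))

theorem separableSpace_traceClassSA [SeparableSpace H] : SeparableSpace (TraceClassSA H) := by
  have := separableSpace_traceClass (H := H)
  have := UniformSpace.secondCountable_of_separable (TraceClass H)
  infer_instance

end Separable

/-! ### Transport of the Banach space structure -/

section Renormed

theorem isSeparableBanachSpace_renormed {𝕜 P E : Type*} [NontriviallyNormedField 𝕜]
    [NormedAddCommGroup P] [NormedSpace 𝕜 P] [CompleteSpace P] [TopologicalSpace.SeparableSpace P]
    [AddCommGroup E] [Module 𝕜 E] (V : Submodule 𝕜 E) (N : E → ℝ) (e : P ≃ₗ[𝕜] V)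
    (h : ∀ u, N (e u) = ‖u‖) : IsSeparableBanachSpace 𝕜 (Renormed V N) := by
  -- The same equivalence, with its target retyped so that `N` is the norm there and the map becomes
  -- an isometry.
  let e' : P ≃ₗ[𝕜] Renormed V N := e
  have he : ∀ v : Renormed V N, ‖v‖ = ‖e'.symm v‖ := fun v => by
    have := h (e'.symm v)
    rw [← this]
    exact congrArg (fun w : V => N w) (e'.apply_symm_apply v).symm
  have core : NormedSpace.Core 𝕜 (Renormed V N) :=
    { norm_nonneg := fun v => by rw [he]; exact norm_nonneg _
      norm_smul := fun c v => by rw [he, map_smul, norm_smul, he]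
      norm_triangle := fun v w => by rw [he, he v, he w, map_add]; exact norm_add_le _ _
      norm_eq_zero_iff := fun v => by rw [he, norm_eq_zero, LinearEquiv.map_eq_zero_iff] }
  let i1 : NormedAddCommGroup (Renormed V N) := NormedAddCommGroup.ofCore core
  have hiso : Isometry e' := AddMonoidHomClass.isometry_of_norm e' fun u => by
    rw [he, e'.symm_apply_apply]
  let f : P ≃ᵢ Renormed V N := ⟨e'.toEquiv, hiso⟩
  exact ⟨core, f.symm.completeSpace, f.surjective.denseRange.separableSpace f.continuous⟩

end Renormed

/-! ### Lifting decompositions to the projective tensor product -/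

section Series

variable {𝕜 E F G : Type*} [RCLike 𝕜] [NormedAddCommGroup E] [NormedSpace 𝕜 E]
  [NormedAddCommGroup F] [NormedSpace 𝕜 F] [NormedAddCommGroup G] [NormedSpace 𝕜 G]
  [CompleteSpace G] [NormedSpace ℝ G] [IsScalarTower ℝ 𝕜 G]
  [NormedSpace ℝ (ProjectiveTensor 𝕜 E F)] [IsScalarTower ℝ 𝕜 (ProjectiveTensor 𝕜 E F)]

theorem projLift_real_smul_tmul (B : E →L[𝕜] F →L[𝕜] G) (r : ℝ) (x : E) (y : F) :
    projLift B (r • projTmul 𝕜 x y) = r • B x y := by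
  rw [← algebraMap_smul 𝕜 r (projTmul 𝕜 x y), map_smul, projLift_tmul, algebraMap_smul]

theorem norm_real_smul_projTmul_le {r : ℝ} (hr : 0 ≤ r) {x : E} {y : F} (h : ‖x‖ * ‖y‖ = 1) :
    ‖r • projTmul 𝕜 x y‖ ≤ r := by
  rw [norm_smul, Real.norm_of_nonneg hr]
  exact mul_le_of_le_one_right hr ((norm_projTmul_le x y).trans_eq h)

/-- A series of weighted simple tensors in the target lifts to the projective tensor product. -/
theorem exists_projLift_eq_of_hasSum (B : E →L[𝕜] F →L[𝕜] G) {ι : Type*} {C : G} {r : ι → ℝ}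
    {X : ι → E} {Y : ι → F} (hr : ∀ k, 0 ≤ r k) (hs : Summable r) (h : ∀ k, ‖X k‖ * ‖Y k‖ = 1)
    (hC : HasSum (fun k => r k • B (X k) (Y k)) C) :
    ∃ u, HasSum (fun k => r k • projTmul 𝕜 (X k) (Y k)) u ∧ projLift B u = C ∧
      ‖u‖ ≤ ∑' k, r k := by
  -- Terms bounded by `r k` give absolute convergence upstairs; the image of the sum is `C` by
  -- continuity and uniqueness of limits.
  have h1 : ∀ k, ‖r k • projTmul 𝕜 (X k) (Y k)‖ ≤ r k := fun k =>
    norm_real_smul_projTmul_le (hr k) (h k)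
  have h2 : HasSum (fun k => r k • projTmul 𝕜 (X k) (Y k))
      (∑' k, r k • projTmul 𝕜 (X k) (Y k)) := (Summable.of_norm_bounded hs h1).hasSum
  refine ⟨_, h2, ?_, tsum_of_norm_bounded hs.hasSum h1⟩
  have h3 := h2.mapL (projLift B)
  simp only [projLift_real_smul_tmul] at h3
  exact h3.unique hC

end Series

theorem sInf_eq_of_forall_le_of_exists_le_add {s : Set ℝ} {a : ℝ} (h : ∀ x ∈ s, a ≤ x)
    (h' : ∀ ε > 0, ∃ x ∈ s, x ≤ a + ε) : sInf s = a := by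
  obtain ⟨x, hx, -⟩ := h' 1 one_pos
  refine le_antisymm (le_of_forall_pos_le_add fun ε hε => ?_) (le_csInf ⟨x, hx⟩ h)
  obtain ⟨y, hy, hya⟩ := h' ε hε
  exact (csInf_le ⟨a, h⟩ hy).trans hya

/-! ### Cross trace class operators -/

section Complex

variable {H : Type*} [NormedAddCommGroup H] [InnerProductSpace ℂ H] [CompleteSpace H]
variable {J : Type*} [NormedAddCommGroup J] [InnerProductSpace ℂ J] [CompleteSpace J]

open TraceClass

theorem immersion_real_smul_tmul (r : ℝ) (A : TraceClass H) (B : TraceClass J) :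
    immersion H J (r • projTmul ℂ A B) = r • tensor A B :=
  projLift_real_smul_tmul TraceClass.tensorBilin r A B

theorem IsStandardDecomposition.exists_immersion {ι : Type} {C : TraceClass (HilbertTensor H J)}
    {r : ι → ℝ} {X : ι → TraceClass H} {Y : ι → TraceClass J}
    (h : IsStandardDecomposition C r X Y) :
    ∃ u, HasSum (fun k => r k • projTmul ℂ (X k) (Y k)) u ∧ immersion H J u = C ∧
      ‖u‖ ≤ ∑' k, r k :=
  exists_projLift_eq_of_hasSum TraceClass.tensorBilin h.nonneg h.summable h.norm_mul_norm h.hasSum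

theorem exists_rankOne_series (u : ProjectiveTensor ℂ (TraceClass H) (TraceClass J)) {ε : ℝ}
    (hε : 0 < ε) :
    ∃ (ι : Type) (_ : Countable ι) (r : ι → ℝ) (X : ι → TraceClass H) (Y : ι → TraceClass J),
      (∀ k, 0 ≤ r k) ∧ Summable r ∧
      (∀ k, IsRankOnePartialIsometry (X k) ∧ IsRankOnePartialIsometry (Y k)) ∧
      HasSum (fun k => r k • projTmul ℂ (X k) (Y k)) u ∧ ∑' k, r k ≤ ‖u‖ + ε := by
  have hS : ∀ s ∈ Set.image2 (projTmul ℂ) {X : TraceClass H | IsRankOnePartialIsometry X}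
      {Y : TraceClass J | IsRankOnePartialIsometry Y}, ‖s‖ ≤ 1 := by
    rintro _ ⟨X, hX, Y, hY, rfl⟩
    refine (norm_projTmul_le X Y).trans_eq ?_
    rw [norm_of_isRankOnePartialIsometry hX, norm_of_isRankOnePartialIsometry hY, one_mul]
  obtain ⟨ι, hι, r, s, hr, hs, hsum, hu, hle⟩ := exists_hasSum_of_closedAtomicCone hS
    (norm_mem_closedAtomicCone_projective norm_mem_closedAtomicCone norm_mem_closedAtomicCone) u hε
  choose X hX Y hY hXY using hs
  simp only [← hXY] at hu
  exact ⟨ι, hι, r, X, Y, hr, hsum, fun k => ⟨hX k, hY k⟩, hu, hle⟩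

theorem exists_rankOne_decomposition (u : ProjectiveTensor ℂ (TraceClass H) (TraceClass J)) {ε : ℝ}
    (hε : 0 < ε) :
    ∃ (ι : Type) (_ : Countable ι) (r : ι → ℝ) (X : ι → TraceClass H) (Y : ι → TraceClass J),
      IsStandardDecomposition (immersion H J u) r X Y ∧
      (∀ k, IsRankOnePartialIsometry (X k) ∧ IsRankOnePartialIsometry (Y k)) ∧
      ∑' k, r k ≤ ‖u‖ + ε := by
  obtain ⟨ι, hι, r, X, Y, hr, hsum, hXY, hu, hle⟩ := exists_rankOne_series u hε
  refine ⟨ι, hι, r, X, Y, ⟨hr, hsum, fun k => ?_, ?_⟩, hXY, hle⟩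
  · rw [norm_of_isRankOnePartialIsometry (hXY k).1, norm_of_isRankOnePartialIsometry (hXY k).2,
      one_mul]
  · have := hu.mapL (immersion H J)
    simpa only [immersion_real_smul_tmul] using this

/-- The lifted decomposition has a sum of norm at most `s`, and injectivity forces that sum to be
`u`. -/
theorem norm_le_of_mem_standardSums {u : ProjectiveTensor ℂ (TraceClass H) (TraceClass J)} {s : ℝ}
    (hs : s ∈ standardSums (immersion H J u)) : ‖u‖ ≤ s := by
  obtain ⟨ι, -, r, X, Y, h, rfl⟩ := hs
  obtain ⟨v, -, hv, hle⟩ := h.exists_immersion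
  rwa [← immersion_injective hv]

theorem rankOneStandardSums_subset (C : TraceClass (HilbertTensor H J)) :
    rankOneStandardSums C ⊆ standardSums C := by
  rintro _ ⟨ι, hι, r, X, Y, h, -, rfl⟩
  exact ⟨ι, hι, r, X, Y, h, rfl⟩

theorem exists_rankOneStandardSums_le (u : ProjectiveTensor ℂ (TraceClass H) (TraceClass J)) :
    ∀ ε > 0, ∃ s ∈ rankOneStandardSums (immersion H J u), s ≤ ‖u‖ + ε := by
  intro ε hε
  obtain ⟨ι, hι, r, X, Y, h, hXY, hle⟩ := exists_rankOne_decomposition u hε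
  exact ⟨_, ⟨ι, hι, r, X, Y, h, hXY, rfl⟩, hle⟩

/-- Every decomposition bounds `‖u‖` from above by lifting. Rank-one decompositions already come
within `ε` of it, so restricting to them leaves the infimum unchanged. -/
theorem crossNorm_immersion (u : ProjectiveTensor ℂ (TraceClass H) (TraceClass J)) :
    crossNorm (immersion H J u) = ‖u‖ :=
  sInf_eq_of_forall_le_of_exists_le_add (fun _ => norm_le_of_mem_standardSums) fun ε hε =>
    (exists_rankOneStandardSums_le u ε hε).imp fun _ h => ⟨rankOneStandardSums_subset _ h.1, h.2⟩

theorem sInf_rankOneStandardSums_immersion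
    (u : ProjectiveTensor ℂ (TraceClass H) (TraceClass J)) :
    sInf (rankOneStandardSums (immersion H J u)) = ‖u‖ :=
  sInf_eq_of_forall_le_of_exists_le_add
    (fun _ h => norm_le_of_mem_standardSums (rankOneStandardSums_subset _ h))
    (exists_rankOneStandardSums_le u)

theorem IsStandardDecomposition.star {ι : Type} {C : TraceClass (HilbertTensor H J)} {r : ι → ℝ}
    {X : ι → TraceClass H} {Y : ι → TraceClass J} (h : IsStandardDecomposition C r X Y) :
    IsStandardDecomposition (star C) r (fun k => star (X k)) (fun k => star (Y k)) where
  nonneg := h.nonneg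
  summable := h.summable
  norm_mul_norm k := by rw [norm_star, norm_star]; exact h.norm_mul_norm k
  hasSum := by
    have h1 := h.hasSum.star
    simpa [real_smul_eq, star_smul, star_tensor, -Complex.coe_smul] using h1

theorem standardSums_subset_star (C : TraceClass (HilbertTensor H J)) :
    standardSums C ⊆ standardSums (star C) := by
  rintro _ ⟨ι, hι, r, X, Y, h, rfl⟩
  exact ⟨ι, hι, r, _, _, h.star, rfl⟩

theorem crossNorm_star (C : TraceClass (HilbertTensor H J)) : crossNorm (star C) = crossNorm C := by
  rw [crossNorm, crossNorm]
  congr 1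
  refine Set.Subset.antisymm ?_ (standardSums_subset_star C)
  simpa using standardSums_subset_star (star C)

theorem immersion_mem (u : ProjectiveTensor ℂ (TraceClass H) (TraceClass J)) :
    immersion H J u ∈ crossTraceClass H J := LinearMap.mem_range_self _ u

theorem exists_of_mem_crossTraceClass {C : TraceClass (HilbertTensor H J)}
    (h : C ∈ crossTraceClass H J) : ∃ u, immersion H J u = C := h

theorem mem_crossTraceClass_iff (C : TraceClass (HilbertTensor H J)) : C ∈ crossTraceClass H J ↔
    ∃ (ι : Type) (_ : Countable ι) (r : ι → ℝ) (X : ι → TraceClass H) (Y : ι → TraceClass J),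
      IsStandardDecomposition C r X Y := by
  constructor
  · rintro h
    obtain ⟨u, rfl⟩ := exists_of_mem_crossTraceClass h
    obtain ⟨ι, hι, r, X, Y, h, -, -⟩ := exists_rankOne_decomposition u one_pos
    exact ⟨ι, hι, r, X, Y, h⟩
  · rintro ⟨ι, hι, r, X, Y, h⟩
    obtain ⟨u, -, rfl, -⟩ := h.exists_immersion
    exact immersion_mem u

theorem star_mem_crossTraceClass {C : TraceClass (HilbertTensor H J)}
    (h : C ∈ crossTraceClass H J) : star C ∈ crossTraceClass H J := by
  rw [mem_crossTraceClass_iff] at h ⊢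
  obtain ⟨ι, hι, r, X, Y, h⟩ := h
  exact ⟨ι, hι, r, _, _, h.star⟩

theorem IsStandardDecomposition.converges {ι : Type} {C : TraceClass (HilbertTensor H J)}
    {r : ι → ℝ} {X : ι → TraceClass H} {Y : ι → TraceClass J}
    (h : IsStandardDecomposition C r X Y) :
    Summable (fun k => ‖r k • tensor (X k) (Y k)‖) ∧
      (∀ k, r k • tensor (X k) (Y k) ∈ crossTraceClass H J) ∧
      Summable (fun k => crossNorm (r k • tensor (X k) (Y k))) ∧
      Filter.Tendsto (fun s : Finset ι => crossNorm (C - ∑ k ∈ s, r k • tensor (X k) (Y k)))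
        Filter.atTop (nhds 0) := by
  obtain ⟨u, hu, rfl, -⟩ := h.exists_immersion
  -- Every operator in sight is an image under the immersion, so `crossNorm` becomes the projective
  -- norm of the preimage.
  simp only [← immersion_real_smul_tmul, ← map_sum, ← map_sub, crossNorm_immersion]
  refine ⟨?_, fun k => immersion_mem _, ?_, ?_⟩
  · refine h.summable.of_nonneg_of_le (fun k => norm_nonneg _) fun k => ?_
    rw [immersion_real_smul_tmul, norm_smul, norm_tensor, h.norm_mul_norm k, mul_one,
      Real.norm_of_nonneg (h.nonneg k)]
  · exact h.summable.of_nonneg_of_le (fun k => norm_nonneg _) fun k =>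
      norm_real_smul_projTmul_le (h.nonneg k) (h.norm_mul_norm k)
  · rw [HasSum, SummationFilter.unconditional_filter, tendsto_iff_norm_sub_tendsto_zero] at hu
    simpa only [norm_sub_rev] using hu

/-- The projective tensor product of the trace classes, identified with the cross trace class. -/
noncomputable def crossEquiv (H J : Type*) [NormedAddCommGroup H] [InnerProductSpace ℂ H]
    [CompleteSpace H] [NormedAddCommGroup J] [InnerProductSpace ℂ J] [CompleteSpace J] :
    ProjectiveTensor ℂ (TraceClass H) (TraceClass J) ≃ₗ[ℂ] crossTraceClass H J :=
  LinearEquiv.ofInjective (immersion H J).toLinearMap immersion_injective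

theorem exists_immersion_eq_mul (u v : ProjectiveTensor ℂ (TraceClass H) (TraceClass J)) {ε : ℝ}
    (hε : 0 < ε) :
    ∃ w, immersion H J w = immersion H J u * immersion H J v ∧
      ‖w‖ ≤ (‖u‖ + ε) * (‖v‖ + ε) := by
  obtain ⟨ι, hι, r, X, Y, h, -, hle⟩ := exists_rankOne_decomposition u hε
  obtain ⟨κ, hκ, s, X', Y', h', -, hle'⟩ := exists_rankOne_decomposition v hε
  -- Two nearly optimal decompositions are multiplied term by term; the weights of the double series
  -- sum to the product of the two totals.
  have hrs : HasSum (fun p : ι × κ => r p.1 * s p.2) ((∑' k, r k) * ∑' k, s k) :=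
    h.summable.hasSum.mul h'.summable.hasSum
      (h.summable.mul_of_nonneg h'.summable h.nonneg h'.nonneg)
  set W : ι × κ → ProjectiveTensor ℂ (TraceClass H) (TraceClass J) := fun p =>
    (r p.1 * s p.2) • projTmul ℂ (X p.1 * X' p.2) (Y p.1 * Y' p.2) with hW
  have hWn : ∀ p, ‖W p‖ ≤ r p.1 * s p.2 := by
    intro p
    have h0 : 0 ≤ r p.1 * s p.2 := mul_nonneg (h.nonneg _) (h'.nonneg _)
    rw [hW, norm_smul, Real.norm_of_nonneg h0]
    refine mul_le_of_le_one_right h0 ((norm_projTmul_le _ _).trans ?_)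
    calc _ ≤ (‖X p.1‖ * ‖X' p.2‖) * (‖Y p.1‖ * ‖Y' p.2‖) :=
          mul_le_mul (TraceClass.norm_mul_le _ _) (TraceClass.norm_mul_le _ _) (norm_nonneg _)
            (by positivity)
      _ = (‖X p.1‖ * ‖Y p.1‖) * (‖X' p.2‖ * ‖Y' p.2‖) := by ring
      _ = 1 := by rw [h.norm_mul_norm, h'.norm_mul_norm, one_mul]
  have hWs : HasSum W (∑' p, W p) := (Summable.of_norm_bounded hrs.summable hWn).hasSum
  refine ⟨∑' p, W p, ?_, (tsum_of_norm_bounded hrs hWn).trans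
    (mul_le_mul hle hle' (tsum_nonneg h'.nonneg) (by positivity))⟩
  -- The product formula is verified for the underlying bounded operators, where the product of the
  -- two series is formed.
  ext1
  have h1 := (hWs.mapL (immersion H J)).mapL (toCLML _)
  have h2 := h.hasSum.mapL (toCLML _)
  have h3 := h'.hasSum.mapL (toCLML _)
  have e1 : ∀ p, toCLML _ (immersion H J (W p)) =
      toCLML _ (r p.1 • tensor (X p.1) (Y p.1)) * toCLML _ (s p.2 • tensor (X' p.2) (Y' p.2)) := by
    intro p
    rw [hW, immersion_real_smul_tmul, tensor_mul]
    simp only [toCLML_apply, toCLM_real_smul, toCLM_mul, smul_mul_smul_comm]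
  have h4 : Summable fun p : ι × κ => toCLML _ (r p.1 • tensor (X p.1) (Y p.1)) *
      toCLML _ (s p.2 • tensor (X' p.2) (Y' p.2)) := h1.summable.congr e1
  have h5 := h2.mul h3 h4
  simp only [e1] at h1
  exact h1.unique h5

theorem mul_mem_crossTraceClass {C D : TraceClass (HilbertTensor H J)}
    (hC : C ∈ crossTraceClass H J) (hD : D ∈ crossTraceClass H J) :
    C * D ∈ crossTraceClass H J := by
  obtain ⟨u, rfl⟩ := exists_of_mem_crossTraceClass hC
  obtain ⟨v, rfl⟩ := exists_of_mem_crossTraceClass hD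
  obtain ⟨w, hw, -⟩ := exists_immersion_eq_mul u v one_pos
  rw [← hw]
  exact immersion_mem w

theorem crossNorm_mul_le {C D : TraceClass (HilbertTensor H J)}
    (hC : C ∈ crossTraceClass H J) (hD : D ∈ crossTraceClass H J) :
    crossNorm (C * D) ≤ crossNorm C * crossNorm D := by
  obtain ⟨u, rfl⟩ := exists_of_mem_crossTraceClass hC
  obtain ⟨v, rfl⟩ := exists_of_mem_crossTraceClass hD
  rw [crossNorm_immersion, crossNorm_immersion]
  -- The chosen decompositions depend on `ε`, but the resulting bound for the product holds for
  -- every `ε > 0`, so `ε` may tend to zero.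
  have h1 : Filter.Tendsto (fun ε : ℝ => (‖u‖ + ε) * (‖v‖ + ε))
      (nhdsWithin 0 (Set.Ioi 0)) (nhds ((‖u‖ + 0) * (‖v‖ + 0))) :=
    (((continuous_const.add continuous_id).mul
      (continuous_const.add continuous_id)).tendsto 0).mono_left nhdsWithin_le_nhds
  rw [add_zero, add_zero] at h1
  refine ge_of_tendsto h1 ?_
  filter_upwards [self_mem_nhdsWithin] with ε hε
  obtain ⟨w, hw, hle⟩ := exists_immersion_eq_mul u v hε
  rwa [← hw, crossNorm_immersion]

variable (H J) in
/-- The cross trace class as a star subalgebra of the trace class. -/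
noncomputable def crossSubalgebra : NonUnitalStarSubalgebra ℂ (TraceClass (HilbertTensor H J)) where
  carrier := crossTraceClass H J
  add_mem' := (crossTraceClass H J).add_mem
  zero_mem' := (crossTraceClass H J).zero_mem
  mul_mem' := mul_mem_crossTraceClass
  smul_mem' := fun c _ hC => (crossTraceClass H J).smul_mem c hC
  star_mem' := star_mem_crossTraceClass

end Complex

/-! ### Self-adjoint cross trace class operators -/

section SelfAdjoint

variable {H : Type*} [NormedAddCommGroup H] [InnerProductSpace ℂ H] [CompleteSpace H]
variable {J : Type*} [NormedAddCommGroup J] [InnerProductSpace ℂ J] [CompleteSpace J]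

open TraceClassSA

theorem immersionSA_smul_tmul (r : ℝ) (A : TraceClassSA H) (B : TraceClassSA J) :
    immersionSA H J (r • projTmul ℝ A B) = r • tensor A B := by
  rw [map_smul, immersionSA_tmul]

theorem IsHermitianStandardDecomposition.exists_immersionSA {ι : Type}
    {C : TraceClassSA (HilbertTensor H J)} {r : ι → ℝ} {X : ι → TraceClassSA H}
    {Y : ι → TraceClassSA J} (h : IsHermitianStandardDecomposition C r X Y) :
    ∃ u, HasSum (fun k => r k • projTmul ℝ (X k) (Y k)) u ∧ immersionSA H J u = C ∧
      ‖u‖ ≤ ∑' k, r k :=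
  exists_projLift_eq_of_hasSum TraceClassSA.tensorBilin h.nonneg h.summable h.norm_mul_norm h.hasSum

theorem exists_hermitian_decomposition
    (u : ProjectiveTensor ℝ (TraceClassSA H) (TraceClassSA J)) {ε : ℝ} (hε : 0 < ε) :
    ∃ (ι : Type) (_ : Countable ι) (r : ι → ℝ) (X : ι → TraceClassSA H) (Y : ι → TraceClassSA J),
      IsHermitianStandardDecomposition (immersionSA H J u) r X Y ∧ ∑' k, r k ≤ ‖u‖ + ε := by
  -- Here the atoms are tensors of arbitrary self-adjoint operators of trace norm one.
  have hS : ∀ s ∈ Set.image2 (projTmul ℝ) {X : TraceClassSA H | ‖X‖ = 1}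
      {Y : TraceClassSA J | ‖Y‖ = 1}, ‖s‖ ≤ 1 := by
    rintro _ ⟨X, hX, Y, hY, rfl⟩
    refine (norm_projTmul_le X Y).trans_eq ?_
    rw [hX, hY, one_mul]
  obtain ⟨ι, hι, r, s, hr, hs, hsum, hu, hle⟩ := exists_hasSum_of_closedAtomicCone hS
    (norm_mem_closedAtomicCone_projective
      (fun X => atomicCone_le_closed _ (norm_mem_atomicCone_sphere X))
      (fun Y => atomicCone_le_closed _ (norm_mem_atomicCone_sphere Y))) u hε
  choose X hX Y hY hXY using hs
  simp only [← hXY] at hu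
  refine ⟨ι, hι, r, X, Y, ⟨hr, hsum, fun k => ?_, ?_⟩, hle⟩
  · rw [hX k, hY k, one_mul]
  · have := hu.mapL (immersionSA H J)
    simpa only [immersionSA_smul_tmul] using this

theorem crossNormSA_immersionSA (u : ProjectiveTensor ℝ (TraceClassSA H) (TraceClassSA J)) :
    crossNormSA (immersionSA H J u) = ‖u‖ := by
  refine sInf_eq_of_forall_le_of_exists_le_add ?_ fun ε hε => ?_
  · rintro _ ⟨ι, -, r, X, Y, h, rfl⟩
    obtain ⟨v, -, hv, hle⟩ := h.exists_immersionSA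
    rwa [← immersionSA_injective hv]
  · obtain ⟨ι, hι, r, X, Y, h, hle⟩ := exists_hermitian_decomposition u hε
    exact ⟨_, ⟨ι, hι, r, X, Y, h, rfl⟩, hle⟩

theorem immersionSA_mem (u : ProjectiveTensor ℝ (TraceClassSA H) (TraceClassSA J)) :
    immersionSA H J u ∈ crossTraceClassSA H J := LinearMap.mem_range_self _ u

theorem exists_of_mem_crossTraceClassSA {C : TraceClassSA (HilbertTensor H J)}
    (h : C ∈ crossTraceClassSA H J) : ∃ u, immersionSA H J u = C := h

theorem mem_crossTraceClassSA_iff (C : TraceClassSA (HilbertTensor H J)) :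
    C ∈ crossTraceClassSA H J ↔
    ∃ (ι : Type) (_ : Countable ι) (r : ι → ℝ) (X : ι → TraceClassSA H) (Y : ι → TraceClassSA J),
      IsHermitianStandardDecomposition C r X Y := by
  constructor
  · rintro h
    obtain ⟨u, rfl⟩ := exists_of_mem_crossTraceClassSA h
    obtain ⟨ι, hι, r, X, Y, h, -⟩ := exists_hermitian_decomposition u one_pos
    exact ⟨ι, hι, r, X, Y, h⟩
  · rintro ⟨ι, hι, r, X, Y, h⟩
    obtain ⟨u, -, rfl, -⟩ := h.exists_immersionSA
    exact immersionSA_mem u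

theorem IsHermitianStandardDecomposition.converges {ι : Type}
    {C : TraceClassSA (HilbertTensor H J)} {r : ι → ℝ} {X : ι → TraceClassSA H}
    {Y : ι → TraceClassSA J} (h : IsHermitianStandardDecomposition C r X Y) :
    Summable (fun k => ‖r k • tensor (X k) (Y k)‖) ∧
      (∀ k, r k • tensor (X k) (Y k) ∈ crossTraceClassSA H J) ∧
      Summable (fun k => crossNormSA (r k • tensor (X k) (Y k))) ∧
      Filter.Tendsto (fun s : Finset ι => crossNormSA (C - ∑ k ∈ s, r k • tensor (X k) (Y k)))
        Filter.atTop (nhds 0) := by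
  obtain ⟨u, hu, rfl, -⟩ := h.exists_immersionSA
  simp only [← immersionSA_smul_tmul, ← map_sum, ← map_sub, crossNormSA_immersionSA]
  refine ⟨?_, fun k => immersionSA_mem _, ?_, ?_⟩
  · refine h.summable.of_nonneg_of_le (fun k => norm_nonneg _) fun k => ?_
    have h1 : ‖tensor (X k) (Y k)‖ = ‖X k‖ * ‖Y k‖ := TraceClass.norm_tensor (X k).1 (Y k).1
    rw [immersionSA_smul_tmul, norm_smul, h1, h.norm_mul_norm k, mul_one,
      Real.norm_of_nonneg (h.nonneg k)]
  · exact h.summable.of_nonneg_of_le (fun k => norm_nonneg _) fun k =>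
      norm_real_smul_projTmul_le (h.nonneg k) (h.norm_mul_norm k)
  · rw [HasSum, SummationFilter.unconditional_filter, tendsto_iff_norm_sub_tendsto_zero] at hu
    simpa only [norm_sub_rev] using hu

/-- The projective tensor product of the self-adjoint trace classes, identified with the
self-adjoint cross trace class. -/
noncomputable def crossEquivSA (H J : Type*) [NormedAddCommGroup H] [InnerProductSpace ℂ H]
    [CompleteSpace H] [NormedAddCommGroup J] [InnerProductSpace ℂ J] [CompleteSpace J] :
    ProjectiveTensor ℝ (TraceClassSA H) (TraceClassSA J) ≃ₗ[ℝ] crossTraceClassSA H J :=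
  LinearEquiv.ofInjective (immersionSA H J).toLinearMap immersionSA_injective

theorem coe_mem_crossTraceClass {C : TraceClassSA (HilbertTensor H J)}
    (hC : C ∈ crossTraceClassSA H J) : C.1 ∈ crossTraceClass H J := by
  rw [mem_crossTraceClassSA_iff] at hC
  obtain ⟨ι, hι, r, X, Y, h⟩ := hC
  refine (mem_crossTraceClass_iff _).mpr ⟨ι, hι, r, fun k => (X k).1, fun k => (Y k).1,
    h.nonneg, h.summable, h.norm_mul_norm, ?_⟩
  exact h.hasSum.mapL (selfAdjoint.submodule ℝ (TraceClass (HilbertTensor H J))).subtypeL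

theorem norm_ofRealPart_I_smul_le (A : TraceClass H) :
    ‖ofRealPart H (-Complex.I • A)‖ ≤ ‖A‖ :=
  (norm_ofRealPart_le _).trans_eq (by rw [norm_smul]; simp)

/-- The self-adjoint part of a cross trace class operator is a self-adjoint cross trace class
operator. -/
theorem ofRealPart_mem_crossTraceClassSA {C : TraceClass (HilbertTensor H J)}
    (hC : C ∈ crossTraceClass H J) : ofRealPart _ C ∈ crossTraceClassSA H J := by
  rw [mem_crossTraceClass_iff] at hC
  obtain ⟨ι, hι, r, X, Y, h⟩ := hC
  have h1 := h.hasSum.mapL (ofRealPart (HilbertTensor H J))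
  -- Taking real or imaginary parts does not increase the trace norm, so the series built from them
  -- are still dominated by `r` in the real projective tensor product.
  have hsum : ∀ (S : ι → TraceClassSA H) (T : ι → TraceClassSA J), (∀ k, ‖S k‖ ≤ ‖X k‖) →
      (∀ k, ‖T k‖ ≤ ‖Y k‖) → Summable fun k => r k • projTmul ℝ (S k) (T k) := by
    intro S T hS hT
    refine Summable.of_norm_bounded h.summable fun k => ?_
    rw [norm_smul, Real.norm_of_nonneg (h.nonneg k)]
    refine mul_le_of_le_one_right (h.nonneg k) ((norm_projTmul_le _ _).trans ?_)
    rw [← h.norm_mul_norm k]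
    exact mul_le_mul (hS k) (hT k) (norm_nonneg _) (norm_nonneg _)
  have s1 := hsum (fun k => ofRealPart H (X k)) (fun k => ofRealPart J (Y k))
    (fun k => norm_ofRealPart_le _) (fun k => norm_ofRealPart_le _)
  have s2 := hsum (fun k => ofRealPart H (-Complex.I • X k))
    (fun k => ofRealPart J (-Complex.I • Y k)) (fun k => norm_ofRealPart_I_smul_le _)
    (fun k => norm_ofRealPart_I_smul_le _)
  -- The preimage is the difference of the series of `Re X_k ⊗ Re Y_k` and of `Im X_k ⊗ Im Y_k`.
  -- Only membership is concluded; the two norms are not compared.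
  have h2 := (s1.sub s2).hasSum.mapL (immersionSA H J)
  have h3 := h2.unique (by
    simpa only [map_sub, immersionSA_tmul, map_smul, ofRealPart_tensor, smul_sub] using h1)
  rw [← h3]
  exact immersionSA_mem _

theorem image_crossTraceClassSA :
    Subtype.val '' (crossTraceClassSA H J : Set (TraceClassSA (HilbertTensor H J))) =
      {C : TraceClass (HilbertTensor H J) | C ∈ crossTraceClass H J ∧ C = star C} := by
  ext C
  constructor
  · rintro ⟨C, hC, rfl⟩
    exact ⟨coe_mem_crossTraceClass hC, (star_coe C).symm⟩
  · rintro ⟨hC, hs⟩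
    have h := ofRealPart_mem_crossTraceClassSA hC
    have h1 : ofRealPart _ C = ⟨C, hs.symm⟩ :=
      ofRealPart_coe (⟨C, hs.symm⟩ : TraceClassSA (HilbertTensor H J))
    rw [h1] at h
    exact ⟨_, h, rfl⟩

end SelfAdjoint

end CrossTrace

open CrossTrace in
theorem mainTheorem7
    (H : Type*) [NormedAddCommGroup H] [InnerProductSpace ℂ H] [CompleteSpace H]
    [TopologicalSpace.SeparableSpace H]
    (J : Type*) [NormedAddCommGroup J] [InnerProductSpace ℂ J] [CompleteSpace J]
    [TopologicalSpace.SeparableSpace J] :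
    -- characterization of the cross trace class operators
    (∀ C : TraceClass (HilbertTensor H J), C ∈ crossTraceClass H J ↔
      ∃ (ι : Type) (_ : Countable ι) (r : ι → ℝ) (X : ι → TraceClass H) (Y : ι → TraceClass J),
        IsStandardDecomposition C r X Y) ∧
    -- the `X_k` and `Y_k` can be taken to be rank-one partial isometries
    (∀ C ∈ crossTraceClass H J,
      ∃ (ι : Type) (_ : Countable ι) (r : ι → ℝ) (X : ι → TraceClass H) (Y : ι → TraceClass J),
        IsStandardDecomposition C r X Y ∧
        ∀ k, IsRankOnePartialIsometry (X k) ∧ IsRankOnePartialIsometry (Y k)) ∧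
    -- standard decompositions converge absolutely, in the trace norm and in the projective norm,
    -- and can be taken adjoint term by term
    (∀ (ι : Type) (_ : Countable ι) (C : TraceClass (HilbertTensor H J)) (r : ι → ℝ)
      (X : ι → TraceClass H) (Y : ι → TraceClass J), IsStandardDecomposition C r X Y →
        Summable (fun k => ‖r k • TraceClass.tensor (X k) (Y k)‖) ∧
        (∀ k, r k • TraceClass.tensor (X k) (Y k) ∈ crossTraceClass H J) ∧
        Summable (fun k => crossNorm (r k • TraceClass.tensor (X k) (Y k))) ∧
        Filter.Tendsto
          (fun s : Finset ι => crossNorm (C - ∑ k ∈ s, r k • TraceClass.tensor (X k) (Y k)))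
          Filter.atTop (nhds 0) ∧
        star C ∈ crossTraceClass H J ∧
        IsStandardDecomposition (star C) r (fun k => star (X k)) (fun k => star (Y k))) ∧
    -- the Banach space of cross trace class operators
    IsSeparableBanachSpace ℂ (Renormed (crossTraceClass H J) crossNorm) ∧
    (∃ e : ProjectiveTensor ℂ (TraceClass H) (TraceClass J) ≃ₗ[ℂ] crossTraceClass H J,
      ∀ u, (e u : TraceClass (HilbertTensor H J)) = immersion H J u ∧
        crossNorm (e u : TraceClass (HilbertTensor H J)) = ‖u‖) ∧
    (∀ C ∈ crossTraceClass H J, crossNorm C = sInf (rankOneStandardSums C)) ∧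
    (∀ C ∈ crossTraceClass H J, crossNorm (star C) = crossNorm C) ∧
    -- characterization of the self-adjoint cross trace class operators
    (∀ C : TraceClassSA (HilbertTensor H J), C ∈ crossTraceClassSA H J ↔
      ∃ (ι : Type) (_ : Countable ι) (r : ι → ℝ) (X : ι → TraceClassSA H)
        (Y : ι → TraceClassSA J), IsHermitianStandardDecomposition C r X Y) ∧
    (∀ (ι : Type) (_ : Countable ι) (C : TraceClassSA (HilbertTensor H J)) (r : ι → ℝ)
      (X : ι → TraceClassSA H) (Y : ι → TraceClassSA J),
        IsHermitianStandardDecomposition C r X Y →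
        Summable (fun k => ‖r k • TraceClassSA.tensor (X k) (Y k)‖) ∧
        (∀ k, r k • TraceClassSA.tensor (X k) (Y k) ∈ crossTraceClassSA H J) ∧
        Summable (fun k => crossNormSA (r k • TraceClassSA.tensor (X k) (Y k))) ∧
        Filter.Tendsto
          (fun s : Finset ι => crossNormSA (C - ∑ k ∈ s, r k • TraceClassSA.tensor (X k) (Y k)))
          Filter.atTop (nhds 0)) ∧
    -- the real Banach space of self-adjoint cross trace class operators
    IsSeparableBanachSpace ℝ (Renormed (crossTraceClassSA H J) crossNormSA) ∧
    (∃ e : ProjectiveTensor ℝ (TraceClassSA H) (TraceClassSA J) ≃ₗ[ℝ] crossTraceClassSA H J,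
      ∀ u, (e u : TraceClassSA (HilbertTensor H J)) = immersionSA H J u ∧
        crossNormSA (e u : TraceClassSA (HilbertTensor H J)) = ‖u‖) ∧
    -- the self-adjoint cross trace class operators are the self-adjoint elements of the cross
    -- trace class
    (Subtype.val '' (crossTraceClassSA H J : Set (TraceClassSA (HilbertTensor H J))) =
      {C : TraceClass (HilbertTensor H J) | C ∈ crossTraceClass H J ∧ C = star C}) ∧
    -- together with the isometry of the adjoint: the cross trace class is a Banach star algebra
    (∃ A : NonUnitalStarSubalgebra ℂ (TraceClass (HilbertTensor H J)),
      (A : Set (TraceClass (HilbertTensor H J))) = crossTraceClass H J ∧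
      ∀ C ∈ A, ∀ D ∈ A, crossNorm (C * D) ≤ crossNorm C * crossNorm D) := by
  -- Separability of `H` and `J` enters only through the separability of the two Banach spaces;
  -- countability of the decompositions comes from the stagewise construction of the series.
  have : TopologicalSpace.SeparableSpace (TraceClass H) := separableSpace_traceClass
  have : TopologicalSpace.SeparableSpace (TraceClass J) := separableSpace_traceClass
  have : TopologicalSpace.SeparableSpace (TraceClassSA H) := separableSpace_traceClassSA
  have : TopologicalSpace.SeparableSpace (TraceClassSA J) := separableSpace_traceClassSA
  have : TopologicalSpace.SeparableSpace (ProjectiveTensor ℂ (TraceClass H) (TraceClass J)) :=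
    separableSpace_projectiveTensor
  have : TopologicalSpace.SeparableSpace (ProjectiveTensor ℝ (TraceClassSA H) (TraceClassSA J)) :=
    separableSpace_projectiveTensor
  refine ⟨mem_crossTraceClass_iff, ?_, ?_, ?_, ?_, ?_, fun C _ => crossNorm_star C,
    mem_crossTraceClassSA_iff, fun ι _ C r X Y h => h.converges, ?_, ?_, image_crossTraceClassSA,
    crossSubalgebra H J, rfl, fun C hC D hD => crossNorm_mul_le hC hD⟩
  · intro C hC
    obtain ⟨u, rfl⟩ := exists_of_mem_crossTraceClass hC
    obtain ⟨ι, hι, r, X, Y, h, hXY, -⟩ := exists_rankOne_decomposition u one_pos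
    exact ⟨ι, hι, r, X, Y, h, hXY⟩
  · intro ι hι C r X Y h
    obtain ⟨h1, h2, h3, h4⟩ := h.converges
    exact ⟨h1, h2, h3, h4, (mem_crossTraceClass_iff _).mpr ⟨ι, hι, r, _, _, h.star⟩, h.star⟩
  · exact isSeparableBanachSpace_renormed _ _ (crossEquiv H J) crossNorm_immersion
  · exact ⟨crossEquiv H J, fun u => ⟨rfl, crossNorm_immersion u⟩⟩
  · intro C hC
    obtain ⟨u, rfl⟩ := exists_of_mem_crossTraceClass hC
    rw [crossNorm_immersion, sInf_rankOneStandardSums_immersion]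
  · exact isSeparableBanachSpace_renormed _ _ (crossEquivSA H J) crossNormSA_immersionSA
  · exact ⟨crossEquivSA H J, fun u => ⟨rfl, crossNormSA_immersionSA u⟩⟩
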